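/- Let $\mathbb{K}$ be an algebraically closed field of characteristic zero. All superalgebras are finite-dimensional associative (not necessarily unital) $\mathbb{Z}_2$-graded $\mathbb{K}$-algebras $A=A_{\bar 0}\oplus A_{\bar 1}$. An even-symmetric structure on $A$ is a bilinear form $B$ that is even ($B(A_{\bar 0},A_{\bar 1})=B(A_{\bar 1},A_{\bar 0})=\{0\}$), supersymmetric ($B(x,y)=(-1)^{|x||y|}B(y,x)$ for homogeneous $x,y$), associative ($B(xy,z)=B(x,yz)$) and non-degenerate; $(A,B)$ is then called an even-symmetric associative superalgebra. $A_{\bar 0}$ is a semisimple $A_{\bar 0}$-bimodule if every subspace $M\subseteq A_{\bar 0}$ with $A_{\bar 0}M\subseteq M$ and $MA_{\bar 0}\subseteq M$ has a complement in $A_{\bar 0}$ of the same kind. For a linear endomorphism $D$ of $(W,B)$, $D^*$ denotes the linear map with $B(D^*(x),y)=B(x,D(y))$ for all $x,y\in W$ (no sign). Let $\mathcal{O}$ consist of $\{0\}$, the one-dimensional (purely even) algebra with null product, and the matrix superalgebras $M_{r,s}(\mathbb{K})$, $r\ge 1$, $s\ge 0$: the $(r+s)\times(r+s)$ matrices, with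 block-diagonal even part and block-antidiagonal odd part. Membership in $\mathcal{O}$ is understood up to isomorphism of superalgebras, and elements of $\mathcal{O}$ may carry any even-symmetric structure. Let $(W,*,B)$ be an even-symmetric associative superalgebra, and consider the following constructions. (1) Elementary even double extension of $W$. Suppose that $W_{\bar 0}$ is a semisimple $W_{\bar 0}$-bimodule, and let $D$ be an even linear endomorphism of $W$ with $D|_{W_{\bar 0}}=0$, $D^2=0$, $DD^*=D^*D$, $D(x)*y=0$ for $x,y\in W_{\bar 1}$, $D(x*y)=0$ for $x\in W_{\bar 0}$, $y\in W_{\bar 1}$, and $D(x*y)=D(x)*y$ for $x\in W_{\bar 1}$, $y\in W_{\bar 0}$. The extension is $\mathbb{K}e^*\oplus W\oplus\mathbb{K}e$ with $e,e^*$ even and, for $x,y\in W$, the product in which $e^*$ multiplies to zero with everything on both sides, $ee=0$, $ex=D(x)$, $xe=D^*(x)$, $xy=x*y+B(D(x),y)e^*$. (2) Odd generalized double extension of $W$. Let $D$ be an odd linear endomorphism of $W$ and $x_0\in W_{\bar 0}$ with $B(x_0,x_0)=0$, $D(x_0)=D^*(x_0)$, $D^2(x)=x_0*x$, $DD^*=D^*D$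 and $D(x*y)=D(x)*y$ for all $x,y\in W$. The extension is $\mathbb{K}e^*\oplus W\oplus\mathbb{K}e$ with $e,e^*$ odd and, for $x,y\in W$, the product in which $e^*$ multiplies to zero with everything on both sides, $ee=x_0$, $ex=D(x)-B(x,x_0)e^*$, $xe=D^*(x)+B(x,x_0)e^*$, $xy=x*y-B(D(x),y)e^*$. In both cases the even-symmetric structure is the supersymmetric form that extends $B$, with $e$ and $e^*$ orthogonal to $W$, $e^*$ paired with $e$ to $1$, and $e$ and $e^*$ each paired with itself to $0$. (3) Orthogonal direct sum of two even-symmetric associative superalgebras: componentwise grading and product, and the sum of the two forms. Theorem. Let $(A,B)$ be an even-symmetric associative superalgebra such that $A_{\bar 0}$ is a semisimple $A_{\bar 0}$-bimodule. If $A\notin\mathcal{O}$, then $(A,B)$ is obtained, up to isometric isomorphism of superalgebras, from finitely many elements of $\mathcal{O}$ by a finite sequence of elementary even double extensions, odd generalized double extensions and orthogonal direct sums. -/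

import Mathlib

universe u v w

/-- A finite-dimensional associative superalgebra over `K`, not necessarily unital:
an associative `K`-algebra `A = A_0 ⊕ A_1` with `A_i A_j ⊆ A_(i+j)` for `i j : ZMod 2`. -/
structure AssocSuperalgebra (K : Type u) [Field K] where
  carrier : Type v
  [ring : NonUnitalRing carrier]
  [module : Module K carrier]
  [isScalarTower : IsScalarTower K carrier carrier]
  [smulCommClass : SMulCommClass K carrier carrier]
  [finite : Module.Finite K carrier]
  /-- the homogeneous components -/
  gr : ZMod 2 → Submodule K carrier
  isInternal : DirectSum.IsInternal gr
  mul_mem : ∀ (i j : ZMod 2) (x y : carrier), x ∈ gr i → y ∈ gr j → x * y ∈ gr (i + j)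

namespace AssocSuperalgebra

variable {K : Type u} [Field K]

instance : CoeSort (AssocSuperalgebra.{u, v} K) (Type v) := ⟨carrier⟩

attribute [instance] ring module isScalarTower smulCommClass finite

/-- `M` is an `A_0`-sub-bimodule of `A_0`. -/
def IsEvenSubbimodule (A : AssocSuperalgebra.{u, v} K) (M : Submodule K A) : Prop :=
  M ≤ A.gr 0 ∧ ∀ a ∈ A.gr 0, ∀ m ∈ M, a * m ∈ M ∧ m * a ∈ M

/-- `A_0` is a semisimple `A_0`-bimodule: every sub-bimodule has a complementary
sub-bimodule. -/
def EvenPartSemisimple (A : AssocSuperalgebra.{u, v} K) : Prop :=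
  ∀ M : Submodule K A, A.IsEvenSubbimodule M →
    ∃ N : Submodule K A, A.IsEvenSubbimodule N ∧ M ⊓ N = ⊥ ∧ M ⊔ N = A.gr 0

/-- Isomorphism of superalgebras: a linear bijection that respects products and degrees. -/
def Isomorphic (A : AssocSuperalgebra.{u, v} K) (B : AssocSuperalgebra.{u, w} K) : Prop :=
  ∃ φ : A ≃ₗ[K] B, (∀ x y : A, φ (x * y) = φ x * φ y) ∧
    ∀ (i : ZMod 2) (x : A), φ x ∈ B.gr i ↔ x ∈ A.gr i

/-- The homogeneous components of the matrix superalgebra: a matrix is of degree `i` if its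
entries at the positions whose row and column parities do not add up to `i` vanish, i.e.
the block-diagonal matrices for `i = 0`, the block-antidiagonal ones for `i = 1`. -/
def matrixGr (K : Type u) [Field K] (r s : ℕ) (i : ZMod 2) :
    Submodule K (Matrix (Fin r ⊕ Fin s) (Fin r ⊕ Fin s) K) where
  carrier := {M | (i ≠ 0 → M.toBlocks₁₁ = 0 ∧ M.toBlocks₂₂ = 0) ∧
    (i ≠ 1 → M.toBlocks₁₂ = 0 ∧ M.toBlocks₂₁ = 0)}
  zero_mem' := ⟨fun _ => ⟨rfl, rfl⟩, fun _ => ⟨rfl, rfl⟩⟩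
  add_mem' := by
    rintro M N ⟨h1, h2⟩ ⟨h3, h4⟩
    refine ⟨fun h => ?_, fun h => ?_⟩
    · obtain ⟨a, b⟩ := h1 h
      obtain ⟨c, d⟩ := h3 h
      exact ⟨(congrArg₂ (· + ·) a c).trans (add_zero 0),
        (congrArg₂ (· + ·) b d).trans (add_zero 0)⟩
    · obtain ⟨a, b⟩ := h2 h
      obtain ⟨c, d⟩ := h4 h
      exact ⟨(congrArg₂ (· + ·) a c).trans (add_zero 0),
        (congrArg₂ (· + ·) b d).trans (add_zero 0)⟩
  smul_mem' := by
    rintro c M ⟨h1, h2⟩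
    refine ⟨fun h => ?_, fun h => ?_⟩
    · obtain ⟨a, b⟩ := h1 h
      exact ⟨(congrArg (c • ·) a).trans (smul_zero c), (congrArg (c • ·) b).trans (smul_zero c)⟩
    · obtain ⟨a, b⟩ := h2 h
      exact ⟨(congrArg (c • ·) a).trans (smul_zero c), (congrArg (c • ·) b).trans (smul_zero c)⟩

theorem mem_matrixGr_zero {r s : ℕ} {M : Matrix (Fin r ⊕ Fin s) (Fin r ⊕ Fin s) K} :
    M ∈ matrixGr K r s 0 ↔ M.toBlocks₁₂ = 0 ∧ M.toBlocks₂₁ = 0 :=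
  ⟨fun h => h.2 (by decide), fun h => ⟨fun h0 => absurd rfl h0, fun _ => h⟩⟩

theorem mem_matrixGr_one {r s : ℕ} {M : Matrix (Fin r ⊕ Fin s) (Fin r ⊕ Fin s) K} :
    M ∈ matrixGr K r s 1 ↔ M.toBlocks₁₁ = 0 ∧ M.toBlocks₂₂ = 0 :=
  ⟨fun h => h.1 (by decide), fun h => ⟨fun _ => h, fun h0 => absurd rfl h0⟩⟩

theorem matrixGr_isCompl (K : Type u) [Field K] (r s : ℕ) :
    IsCompl (matrixGr K r s 0) (matrixGr K r s 1) := by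
  constructor
  · rw [Submodule.disjoint_def]
    intro M h0 h1
    rw [mem_matrixGr_zero] at h0
    rw [mem_matrixGr_one] at h1
    rw [← Matrix.fromBlocks_toBlocks M, h0.1, h0.2, h1.1, h1.2, Matrix.fromBlocks_zero]
  · rw [codisjoint_iff, eq_top_iff]
    intro M _
    rw [Submodule.mem_sup]
    refine ⟨Matrix.fromBlocks M.toBlocks₁₁ 0 0 M.toBlocks₂₂, ?_,
      Matrix.fromBlocks 0 M.toBlocks₁₂ M.toBlocks₂₁ 0, ?_, ?_⟩
    · rw [mem_matrixGr_zero]; simp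
    · rw [mem_matrixGr_one]; simp
    · rw [Matrix.fromBlocks_add]
      simp [Matrix.fromBlocks_toBlocks]

theorem matrixGr_mul_mem {r s : ℕ} (i j : ZMod 2)
    (M N : Matrix (Fin r ⊕ Fin s) (Fin r ⊕ Fin s) K)
    (hM : M ∈ matrixGr K r s i) (hN : N ∈ matrixGr K r s j) :
    M * N ∈ matrixGr K r s (i + j) := by
  have h2 : (1 + 1 : ZMod 2) = 0 := by decide
  have hi : ∀ k : ZMod 2, k = 0 ∨ k = 1 := by decide
  rw [← Matrix.fromBlocks_toBlocks M, ← Matrix.fromBlocks_toBlocks N, Matrix.fromBlocks_multiply]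
  rcases hi i with rfl | rfl <;> rcases hi j with rfl | rfl <;>
    simp_all [mem_matrixGr_zero, mem_matrixGr_one]

/-- The superalgebra `M_{r,s}(K)` of `(r+s) × (r+s)` matrices, graded by blocks. -/
def matrixSuperalgebra (K : Type u) [Field K] (r s : ℕ) : AssocSuperalgebra.{u, u} K where
  carrier := Matrix (Fin r ⊕ Fin s) (Fin r ⊕ Fin s) K
  gr := matrixGr K r s
  isInternal := by
    rw [DirectSum.isInternal_submodule_iff_isCompl (i := (0 : ZMod 2)) (j := 1) _ (by decide)
      (by ext k; revert k; decide)]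
    exact matrixGr_isCompl K r s
  mul_mem := matrixGr_mul_mem

/-- Membership, up to isomorphism of superalgebras, in the set `O` that consists of `{0}`, the
one-dimensional (purely even) algebra with null product, and `M_{r,s}(K)`, `r ≥ 1`, `s ≥ 0`. -/
def MemO (A : AssocSuperalgebra.{u, v} K) : Prop :=
  Module.finrank K A = 0 ∨
  (Module.finrank K A = 1 ∧ A.gr 0 = ⊤ ∧ ∀ x y : A, x * y = 0) ∨
  ∃ r s : ℕ, 1 ≤ r ∧ A.Isomorphic (matrixSuperalgebra K r s)

end AssocSuperalgebra

/-- An even-symmetric associative superalgebra: an associative superalgebra with an even,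
supersymmetric, associative, non-degenerate bilinear form. -/
structure EvenSymmSuperalgebra (K : Type u) [Field K] extends AssocSuperalgebra.{u, v} K where
  form : LinearMap.BilinForm K carrier
  form_even : ∀ (i j : ZMod 2) (x y : carrier), x ∈ gr i → y ∈ gr j → i + j = 1 → form x y = 0
  form_supersymm : ∀ (i j : ZMod 2) (x y : carrier), x ∈ gr i → y ∈ gr j →
    form x y = (-1) ^ (i.val * j.val) * form y x
  form_assoc : ∀ x y z : carrier, form (x * y) z = form x (y * z)
  form_nondegenerate : ∀ x : carrier, (∀ y : carrier, form x y = 0) → x = 0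

namespace EvenSymmSuperalgebra

variable {K : Type u} [Field K]

instance : CoeSort (EvenSymmSuperalgebra.{u, v} K) (Type v) := ⟨fun A => A.carrier⟩

/-- The endomorphism `D` is homogeneous of degree `ε`. -/
def IsHomogeneousEnd (W : EvenSymmSuperalgebra.{u, v} K) (ε : ZMod 2) (D : W →ₗ[K] W) : Prop :=
  ∀ (i : ZMod 2) (x : W), x ∈ W.gr i → D x ∈ W.gr (i + ε)

/-- The product on `K e* ⊕ W ⊕ K e`, where `e` and `e*` have degree `ε`. The triple
`(α, x, β)` stands for `α e* + x + β e`, and the product is given by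
`e*` annihilates everything, `e e = x₀`, `x y = x * y + (-1)^ε B(D x, y) e*`,
`e x = D x + (-1)^ε B(x, x₀) e*`, `x e = G x + B(x, x₀) e*`. -/
def extMul (W : EvenSymmSuperalgebra.{u, v} K) (ε : ZMod 2) (D G : W →ₗ[K] W) (x₀ : W)
    (p q : K × W × K) : K × W × K :=
  ((-1) ^ ε.val * W.form (D p.2.1) q.2.1 + p.2.2 * ((-1) ^ ε.val * W.form q.2.1 x₀)
      + q.2.2 * W.form p.2.1 x₀,
    p.2.1 * q.2.1 + p.2.2 • D q.2.1 + q.2.2 • G p.2.1 + (p.2.2 * q.2.2) • x₀,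
    0)

/-- The form on `K e* ⊕ W ⊕ K e` that extends the form of `W`, with `B(e*, e) = 1`,
`B(e, e*) = (-1)^ε`, `B(e*, e*) = B(e, e) = 0` and `W` orthogonal to `e` and `e*`. -/
def extForm (W : EvenSymmSuperalgebra.{u, v} K) (ε : ZMod 2) (p q : K × W × K) : K :=
  W.form p.2.1 q.2.1 + p.1 * q.2.2 + (-1) ^ ε.val * (p.2.2 * q.1)

/-- `A` is isometrically isomorphic to `K e* ⊕ W ⊕ K e` with `e`, `e*` of degree `ε` and with
the product and the form above. -/
def IsExtensionBy (W A : EvenSymmSuperalgebra.{u, v} K) (ε : ZMod 2) (D G : W →ₗ[K] W)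
    (x₀ : W) : Prop :=
  ∃ φ : (K × W × K) ≃ₗ[K] A,
    (∀ p q, φ p * φ q = φ (W.extMul ε D G x₀ p q)) ∧
    (∀ p q, A.form (φ p) (φ q) = W.extForm ε p q) ∧
    ∀ (i : ZMod 2) (p : K × W × K),
      φ p ∈ A.gr i ↔ p.2.1 ∈ W.gr i ∧ (i ≠ ε → p.1 = 0 ∧ p.2.2 = 0)

/-- `A` is an elementary even double extension of `W` (whose even part is a semisimple
bimodule) by the one-dimensional algebra with null product; `G` is the adjoint of `D`. -/
def IsElementaryEvenDoubleExtension (W A : EvenSymmSuperalgebra.{u, v} K) : Prop :=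
  W.EvenPartSemisimple ∧
  ∃ D G : W →ₗ[K] W,
    W.IsHomogeneousEnd 0 D ∧
    (∀ x y : W, W.form (G x) y = W.form x (D y)) ∧
    (∀ x ∈ W.gr 0, D x = 0) ∧
    (∀ x : W, D (D x) = 0) ∧
    (∀ x : W, D (G x) = G (D x)) ∧
    (∀ x ∈ W.gr 1, ∀ y ∈ W.gr 1, D x * y = 0) ∧
    (∀ x ∈ W.gr 0, ∀ y ∈ W.gr 1, D (x * y) = 0) ∧
    (∀ x ∈ W.gr 1, ∀ y ∈ W.gr 0, D (x * y) = D x * y) ∧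
    W.IsExtensionBy A 0 D G 0

/-- `A` is an odd generalized double extension of `W` by the one-dimensional superalgebra with
null even part, by means of some `(D, x₀)`. -/
def IsOddGeneralizedDoubleExtension (W A : EvenSymmSuperalgebra.{u, v} K) : Prop :=
  ∃ (D G : W →ₗ[K] W) (x₀ : W),
    W.IsHomogeneousEnd 1 D ∧
    W.IsHomogeneousEnd 1 G ∧
    (∀ x y : W, W.form (G x) y = W.form x (D y)) ∧
    x₀ ∈ W.gr 0 ∧
    W.form x₀ x₀ = 0 ∧
    D x₀ = G x₀ ∧
    (∀ x : W, D (D x) = x₀ * x) ∧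
    (∀ x : W, D (G x) = G (D x)) ∧
    (∀ x y : W, D (x * y) = D x * y) ∧
    W.IsExtensionBy A 1 D G x₀

/-- `A` is isometrically isomorphic to the orthogonal direct sum of `W₁` and `W₂`. -/
def IsOrthogonalDirectSum (W₁ W₂ A : EvenSymmSuperalgebra.{u, v} K) : Prop :=
  ∃ φ : (W₁ × W₂) ≃ₗ[K] A,
    (∀ p q, φ p * φ q = φ (p.1 * q.1, p.2 * q.2)) ∧
    (∀ p q, A.form (φ p) (φ q) = W₁.form p.1 q.1 + W₂.form p.2 q.2) ∧
    ∀ (i : ZMod 2) (p : W₁ × W₂), φ p ∈ A.gr i ↔ p.1 ∈ W₁.gr i ∧ p.2 ∈ W₂.gr i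

/-- `A` is obtained from finitely many elements of `O` (each with an even-symmetric structure)
by a finite sequence of elementary even double extensions, odd generalized double extensions
and orthogonal direct sums. -/
inductive ObtainedFromO : EvenSymmSuperalgebra.{u, v} K → Prop
  | base (A : EvenSymmSuperalgebra.{u, v} K) :
      A.MemO → ObtainedFromO A
  | elementary (W A : EvenSymmSuperalgebra.{u, v} K) :
      ObtainedFromO W → W.IsElementaryEvenDoubleExtension A → ObtainedFromO A
  | odd (W A : EvenSymmSuperalgebra.{u, v} K) :
      ObtainedFromO W → W.IsOddGeneralizedDoubleExtension A → ObtainedFromO A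
  | directSum (W₁ W₂ A : EvenSymmSuperalgebra.{u, v} K) :
      ObtainedFromO W₁ → ObtainedFromO W₂ → IsOrthogonalDirectSum W₁ W₂ A → ObtainedFromO A

end EvenSymmSuperalgebra

/-! ### Homogeneous components and graded subspaces. -/

namespace AssocSuperalgebra

variable {K : Type u} [Field K] (A : AssocSuperalgebra.{u, v} K)

/-! The proof is a strong induction on dim A. Each step either splits off an orthogonal ideal lying
in O or exhibits A as a double extension of a smaller superalgebra. In every case the smaller
superalgebra again has a semisimple even part (`evenPartSemisimple_compress`).

Suppose A_0 A_0 ≠ 0. Semisimplicity yields a minimal left ideal of A_0 with nonzero square, and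
Schur's argument over an algebraically closed field yields an even idempotent p with p A_0 p = K p
(`exists_even_idempotent`). Non-degeneracy forces B(p,p) ≠ 0, and supersymmetry forces p A_1 p = 0
(`IsPrimitiveEven.odd_corner`), so p A p = K p. Homogeneous bases of Ap and pA that are dual under
multiplication (`IsPrimitiveEven.exists_frame`) then identify the ideal ApA with some M_{r,s}(K).
The form is non-degenerate on ApA, which is therefore an orthogonal summand.

Suppose A_0 A_0 = 0 and A ≠ 0. Then some nonzero homogeneous f annihilates A
(`exists_homogeneous_annihilator`). If B(f,f) ≠ 0, the line K f is a one-dimensional null summand.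
Otherwise f is completed to a hyperbolic pair f, e. The orthogonal of the pair, with the projected
product, is an associative superalgebra W, because projection discards only multiples of the
annihilator f. Multiplication by e on the two sides induces D and D*, and A is the double extension
of W, even or odd according to the degree of f (`IsAnnihilatorPair.isExtensionBy`). -/

theorem isCompl_gr : IsCompl (A.gr 0) (A.gr 1) :=
  (DirectSum.isInternal_submodule_iff_isCompl (i := (0 : ZMod 2)) (j := 1) A.gr (by decide)
    (by ext k; revert k; decide)).1 A.isInternal

theorem exists_add_eq (x : A) : ∃ a ∈ A.gr 0, ∃ b ∈ A.gr 1, a + b = x := by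
  have h : x ∈ A.gr 0 ⊔ A.gr 1 := by rw [A.isCompl_gr.sup_eq_top]; trivial
  exact Submodule.mem_sup.1 h

theorem zmod_two_cases (i : ZMod 2) : i = 0 ∨ i = 1 := by revert i; decide

variable {A}

theorem eq_zero_of_mem_gr {i j : ZMod 2} (hij : i ≠ j) {x : A} (hi : x ∈ A.gr i)
    (hj : x ∈ A.gr j) : x = 0 := by
  have h := Submodule.disjoint_def.1 A.isCompl_gr.disjoint x
  rcases zmod_two_cases i with rfl | rfl <;> rcases zmod_two_cases j with rfl | rfl
  · exact absurd rfl hij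
  · exact h hi hj
  · exact h hj hi
  · exact absurd rfl hij

theorem eq_zero_of_add_eq_zero {a b : A} (ha : a ∈ A.gr 0) (hb : b ∈ A.gr 1) (h : a + b = 0) :
    a = 0 ∧ b = 0 := by
  have h' : a = -b := eq_neg_of_add_eq_zero_left h
  have h0 : a = 0 := eq_zero_of_mem_gr (by decide : (0 : ZMod 2) ≠ 1) ha (h' ▸ neg_mem hb)
  exact ⟨h0, by simpa [h0] using h⟩

/-- A property of `A` that is additive holds everywhere once it holds on the homogeneous
elements. -/
theorem homogeneous_induction {p : A → Prop} (h : ∀ i, ∀ x ∈ A.gr i, p x)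
    (hadd : ∀ x y, p x → p y → p (x + y)) (x : A) : p x := by
  obtain ⟨a, ha, b, hb, rfl⟩ := A.exists_add_eq x
  exact hadd _ _ (h 0 a ha) (h 1 b hb)

variable (A) in
/-- The subspace `W` contains the homogeneous components of its elements. -/
def IsGraded (W : Submodule K A) : Prop :=
  ∀ a ∈ A.gr 0, ∀ b ∈ A.gr 1, a + b ∈ W → a ∈ W ∧ b ∈ W

theorem isGraded_span_of_mem {i : ZMod 2} {S : Set A} (hS : ∀ x ∈ S, x ∈ A.gr i) :
    A.IsGraded (Submodule.span K S) := by
  intro a ha b hb hab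
  have h : a + b ∈ A.gr i := Submodule.span_le.2 hS hab
  rcases zmod_two_cases i with rfl | rfl
  · have hb' : b ∈ A.gr 0 := by simpa using sub_mem h ha
    have : b = 0 := eq_zero_of_mem_gr (by decide : (0 : ZMod 2) ≠ 1) hb' hb
    subst this
    exact ⟨by simpa using hab, zero_mem _⟩
  · have ha' : a ∈ A.gr 1 := by simpa using sub_mem h hb
    have : a = 0 := eq_zero_of_mem_gr (by decide : (0 : ZMod 2) ≠ 1) ha ha'
    subst this
    exact ⟨zero_mem _, by simpa using hab⟩

end AssocSuperalgebra

/-! ### Supersymmetric forms, orthogonals and orthogonal projections. -/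

namespace EvenSymmSuperalgebra

open AssocSuperalgebra

variable {K : Type u} [Field K] {A : EvenSymmSuperalgebra.{u, v} K}

theorem form_eq_zero_of_mem {i j : ZMod 2} (hij : i ≠ j) {x y : A} (hx : x ∈ A.gr i)
    (hy : y ∈ A.gr j) : A.form x y = 0 :=
  by
  refine A.form_even i j x y hx hy ?_
  clear hx hy
  revert i j
  decide

theorem form_comm_of_mem {i : ZMod 2} {x : A} (hx : x ∈ A.gr i) (y : A) :
    A.form x y = (-1) ^ i.val * A.form y x := by
  induction y using homogeneous_induction with
  | h j y hy =>
    by_cases hij : i = j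
    · subst hij
      rw [A.form_supersymm i i x y hx hy]
      rcases zmod_two_cases i with rfl | rfl <;> rfl
    · rw [form_eq_zero_of_mem hij hx hy, form_eq_zero_of_mem (Ne.symm hij) hy hx, mul_zero]
  | hadd y z hy hz => simp only [map_add, LinearMap.add_apply, hy, hz, mul_add]

theorem form_comm_of_even {x : A} (hx : x ∈ A.gr 0) (y : A) : A.form x y = A.form y x := by
  simpa using form_comm_of_mem hx y

theorem form_comm_of_odd {x : A} (hx : x ∈ A.gr 1) (y : A) : A.form x y = -A.form y x := by
  have := form_comm_of_mem hx y
  rwa [ZMod.val_one, pow_one, neg_one_mul] at this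

theorem form_eq_zero_comm {i : ZMod 2} {x : A} (hx : x ∈ A.gr i) {y : A} :
    A.form x y = 0 ↔ A.form y x = 0 := by
  rw [form_comm_of_mem hx]; simp

/-- Even elements may be moved cyclically under the form. -/
theorem form_even_mul {p : A} (hp : p ∈ A.gr 0) (x y : A) :
    A.form (p * x) y = A.form x (y * p) := by
  induction x using homogeneous_induction with
  | h i x hx =>
    have h : p * x ∈ A.gr i := by simpa using A.mul_mem 0 i p x hp hx
    rw [form_comm_of_mem h, form_comm_of_mem hx, A.form_assoc]
  | hadd x z hx hz => simp only [mul_add, map_add, LinearMap.add_apply, hx, hz]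

/-- The form is non-degenerate on the subspace `W`. -/
def NondegenerateOn (A : EvenSymmSuperalgebra.{u, v} K) (W : Submodule K A) : Prop :=
  ∀ x ∈ W, (∀ y ∈ W, A.form x y = 0) → x = 0

/-- The orthogonal of the subspace `W`. -/
def orth (A : EvenSymmSuperalgebra.{u, v} K) (W : Submodule K A) : Submodule K A where
  carrier := {x | ∀ y ∈ W, A.form x y = 0}
  zero_mem' := fun y _ => by simp
  add_mem' := fun {a b} ha hb y hy => by simp [ha y hy, hb y hy]
  smul_mem' := fun c a ha y hy => by simp [ha y hy]

/-- The form is symmetric only up to a sign depending on the degree, so left and right orthogonality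
are compared one homogeneous component at a time. This is where gradedness of W enters. -/
theorem form_eq_zero_of_mem_orth {W : Submodule K A} (hW : A.IsGraded W) {x y : A} (hx : x ∈ W)
    (hy : y ∈ A.orth W) : A.form x y = 0 := by
  obtain ⟨a, ha, b, hb, rfl⟩ := A.exists_add_eq x
  obtain ⟨h1, h2⟩ := hW a ha b hb hx
  rw [map_add, LinearMap.add_apply, (form_eq_zero_comm ha).2 (hy a h1),
    (form_eq_zero_comm hb).2 (hy b h2), add_zero]

theorem mem_orth_of_form_eq_zero {W : Submodule K A} (hW : A.IsGraded W) {x : A}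
    (hx : ∀ y ∈ W, A.form y x = 0) : x ∈ A.orth W := by
  intro y hy
  obtain ⟨a, ha, b, hb, rfl⟩ := A.exists_add_eq y
  obtain ⟨h1, h2⟩ := hW a ha b hb hy
  rw [map_add, (form_eq_zero_comm ha).1 (hx a h1), (form_eq_zero_comm hb).1 (hx b h2), add_zero]

theorem isGraded_orth {W : Submodule K A} (hW : A.IsGraded W) : A.IsGraded (A.orth W) := by
  intro a ha b hb hab
  have key : ∀ y ∈ W, A.form a y = 0 ∧ A.form b y = 0 := by
    intro y hy
    obtain ⟨c, hc, d, hd, rfl⟩ := A.exists_add_eq y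
    obtain ⟨h1, h2⟩ := hW c hc d hd hy
    have e1 := hab c h1
    have e2 := hab d h2
    have z1 := form_eq_zero_of_mem (by decide) hb hc
    have z2 := form_eq_zero_of_mem (by decide) ha hd
    rw [map_add, LinearMap.add_apply] at e1 e2
    rw [z1, add_zero] at e1
    rw [z2, zero_add] at e2
    simp [e1, e2, z1, z2]
  exact ⟨fun y hy => (key y hy).1, fun y hy => (key y hy).2⟩

/-- The restricted form embeds W into its dual, which has the same finite dimension, so the
functional B(x, ·) on W is represented by an element of W. -/
theorem exists_sub_mem_orth {W : Submodule K A} (hn : A.NondegenerateOn W) (x : A) :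
    ∃ w ∈ W, x - w ∈ A.orth W := by
  let f : W →ₗ[K] Module.Dual K W := A.form.domRestrict₁₂ W W
  have hinj : Function.Injective f := by
    rw [← LinearMap.ker_eq_bot, LinearMap.ker_eq_bot']
    intro m hm
    exact Subtype.ext (hn m m.2 fun y hy => LinearMap.congr_fun hm ⟨y, hy⟩)
  have hsurj : Function.Surjective f :=
    (LinearMap.injective_iff_surjective_of_finrank_eq_finrank
      Subspace.dual_finrank_eq.symm).1 hinj
  obtain ⟨w, hw⟩ := hsurj ((A.form x).domRestrict W)
  refine ⟨w, w.2, fun y hy => ?_⟩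
  have := LinearMap.congr_fun hw ⟨y, hy⟩
  change A.form w y = A.form x y at this
  rw [map_sub, LinearMap.sub_apply, this, sub_self]

theorem isCompl_orth {W : Submodule K A} (hn : A.NondegenerateOn W) : IsCompl W (A.orth W) := by
  constructor
  · rw [Submodule.disjoint_def]
    exact fun x hx hx' => hn x hx hx'
  · rw [codisjoint_iff, eq_top_iff]
    intro x _
    obtain ⟨w, hw, h⟩ := exists_sub_mem_orth hn x
    exact Submodule.mem_sup.2 ⟨w, hw, x - w, h, add_sub_cancel _ _⟩

theorem nondegenerateOn_orth {W : Submodule K A}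
    (hn : A.NondegenerateOn W) : A.NondegenerateOn (A.orth W) := by
  intro x hx h
  refine A.form_nondegenerate x fun y => ?_
  obtain ⟨w, hw, h'⟩ := exists_sub_mem_orth hn y
  have := h _ h'
  rwa [map_sub, hx w hw, sub_zero] at this

/-- The orthogonal projection onto a non-degenerate subspace. -/
noncomputable def proj (W : Submodule K A) (hn : A.NondegenerateOn W) : A →ₗ[K] W :=
  W.projectionOnto (A.orth W) (isCompl_orth hn)

section proj

variable {W : Submodule K A} (hn : A.NondegenerateOn W)

theorem proj_eq {x w : A} (hw : w ∈ W) (h : x - w ∈ A.orth W) : (proj W hn x : A) = w := by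
  have h1 : proj W hn (x - w) = 0 := by
    rw [proj, Submodule.projectionOnto_apply_eq_zero_iff]; exact h
  rw [map_sub, sub_eq_zero] at h1
  rw [h1]
  exact congrArg Subtype.val (Submodule.projectionOnto_apply_left (isCompl_orth hn) ⟨w, hw⟩)

theorem proj_of_mem {x : A} (hx : x ∈ W) : (proj W hn x : A) = x :=
  proj_eq hn hx (by rw [sub_self]; exact zero_mem _)

theorem sub_proj_mem (x : A) : x - proj W hn x ∈ A.orth W := by
  obtain ⟨w, hw, h⟩ := exists_sub_mem_orth hn x
  rwa [proj_eq hn hw h]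

theorem form_proj_left (x : A) {y : A} (hy : y ∈ W) : A.form (proj W hn x) y = A.form x y := by
  have := sub_proj_mem hn x y hy
  rw [map_sub, LinearMap.sub_apply, sub_eq_zero] at this
  exact this.symm

theorem form_proj_right (hW : A.IsGraded W) {x : A} (hx : x ∈ W) (y : A) :
    A.form x (proj W hn y) = A.form x y := by
  have := form_eq_zero_of_mem_orth hW hx (sub_proj_mem hn y)
  rw [map_sub, sub_eq_zero] at this
  exact this.symm

theorem proj_mem_gr (hW : A.IsGraded W) {i : ZMod 2} {x : A} (hx : x ∈ A.gr i) : (proj W hn x : A) ∈ A.gr i := by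
  obtain ⟨w, hw, h⟩ := exists_sub_mem_orth hn x
  obtain ⟨a, ha, b, hb, rfl⟩ := A.exists_add_eq w
  obtain ⟨h1, h2⟩ := hW a ha b hb hw
  rcases zmod_two_cases i with rfl | rfl
  · have h3 := isGraded_orth hW (x - a) (sub_mem hx ha) (-b) (neg_mem hb)
      (by convert h using 1; abel)
    rw [proj_eq hn h1 h3.1]; exact ha
  · have h3 := isGraded_orth hW (-a) (neg_mem ha) (x - b) (sub_mem hx hb)
      (by convert h using 1; abel)
    rw [proj_eq hn h2 h3.2]; exact hb

end proj

end EvenSymmSuperalgebra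

/-! ### Compression of the product to a non-degenerate subspace. -/

namespace EvenSymmSuperalgebra

open AssocSuperalgebra

variable {K : Type u} [Field K] {A : EvenSymmSuperalgebra.{u, v} K}

/-- The product on a non-degenerate subspace that is obtained from the product of `A` by orthogonal
projection. -/
@[reducible]
noncomputable def compressRing (W : Submodule K A) (hn : A.NondegenerateOn W)
    (hassoc : ∀ x ∈ W, ∀ y ∈ W, ∀ z ∈ W,
      proj W hn ((proj W hn (x * y) : A) * z) = proj W hn (x * (proj W hn (y * z) : A))) :
    NonUnitalRing W where
  __ := (inferInstance : AddCommGroup W)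
  mul x y := proj W hn (x * y : A)
  left_distrib x y z := by
    change proj W hn ((x : A) * ((y : A) + z)) = proj W hn (x * y : A) + proj W hn (x * z : A)
    rw [mul_add, map_add]
  right_distrib x y z := by
    change proj W hn (((x : A) + y) * z) = proj W hn (x * z : A) + proj W hn (y * z : A)
    rw [add_mul, map_add]
  zero_mul x := by
    change proj W hn ((0 : A) * x) = 0
    rw [zero_mul, map_zero]
  mul_zero x := by
    change proj W hn ((x : A) * 0) = 0
    rw [mul_zero, map_zero]
  mul_assoc x y z := hassoc x x.2 y y.2 z z.2

/-- A graded non-degenerate subspace `W` with the restricted form and the product obtained by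
orthogonal projection, provided that this product is associative. -/
noncomputable def compress (W : Submodule K A) (hW : A.IsGraded W) (hn : A.NondegenerateOn W)
    (hassoc : ∀ x ∈ W, ∀ y ∈ W, ∀ z ∈ W,
      proj W hn ((proj W hn (x * y) : A) * z) = proj W hn (x * (proj W hn (y * z) : A))) :
    EvenSymmSuperalgebra.{u, v} K :=
  letI : NonUnitalRing W := compressRing W hn hassoc
  { carrier := W
    ring := compressRing W hn hassoc
    module := (inferInstance : Module K W)
    isScalarTower := ⟨fun c x y => by
      change proj W hn ((c • (x : A)) * y) = c • proj W hn (x * y : A)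
      rw [smul_mul_assoc, map_smul]⟩
    smulCommClass := ⟨fun c x y => by
      change c • proj W hn (x * y : A) = proj W hn ((x : A) * (c • (y : A)))
      rw [mul_smul_comm, map_smul]⟩
    finite := (inferInstance : Module.Finite K W)
    gr := fun i => (A.gr i).comap W.subtype
    isInternal := by
      refine (DirectSum.isInternal_submodule_iff_isCompl (i := (0 : ZMod 2)) (j := 1) _ (by decide)
        (by ext k; revert k; decide)).2 ⟨?_, ?_⟩
      · rw [Submodule.disjoint_def]
        intro x h0 h1
        exact Subtype.ext (eq_zero_of_mem_gr (by decide : (0 : ZMod 2) ≠ 1) h0 h1)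
      · rw [codisjoint_iff, eq_top_iff]
        intro x _
        obtain ⟨a, ha, b, hb, hab⟩ := A.exists_add_eq (x : A)
        obtain ⟨h1, h2⟩ := hW a ha b hb (hab ▸ x.2)
        exact Submodule.mem_sup.2 ⟨⟨a, h1⟩, ha, ⟨b, h2⟩, hb, Subtype.ext hab⟩
    mul_mem := fun i j x y hx hy => proj_mem_gr hn hW (A.mul_mem i j x y hx hy)
    form := A.form.domRestrict₁₂ W W
    form_even := fun i j x y hx hy h => A.form_even i j x y hx hy h
    form_supersymm := fun i j x y hx hy => A.form_supersymm i j x y hx hy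
    form_assoc := fun x y z => by
      change A.form (proj W hn (x * y : A)) z = A.form x (proj W hn (y * z : A))
      rw [form_proj_left hn _ z.2, form_proj_right hn hW x.2, A.form_assoc]
    form_nondegenerate := fun x h => Subtype.ext (hn x x.2 fun y hy => h ⟨y, hy⟩) }

section compress

variable (W : Submodule K A) (hW : A.IsGraded W) (hn : A.NondegenerateOn W)
    (hassoc : ∀ x ∈ W, ∀ y ∈ W, ∀ z ∈ W,
      proj W hn ((proj W hn (x * y) : A) * z) = proj W hn (x * (proj W hn (y * z) : A)))

/-- The inclusion of a compression. -/
noncomputable def compressIncl : compress W hW hn hassoc →ₗ[K] A := W.subtype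

theorem compressIncl_injective : Function.Injective (compressIncl W hW hn hassoc) :=
  Subtype.val_injective

theorem compressIncl_mem (x : compress W hW hn hassoc) : compressIncl W hW hn hassoc x ∈ W :=
  Subtype.property (p := (· ∈ W)) x

theorem compressIncl_mul (x y : compress W hW hn hassoc) :
    compressIncl W hW hn hassoc (x * y) =
      proj W hn (compressIncl W hW hn hassoc x * compressIncl W hW hn hassoc y) := rfl

/-- The linear map to a compression that projects orthogonally. -/
noncomputable def compressProj : A →ₗ[K] compress W hW hn hassoc := proj W hn

/-- Semisimplicity of the even part passes to a compression whose even part has the same left and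
right multiplication operators. -/
theorem evenPartSemisimple_compress (hss : A.EvenPartSemisimple)
    (h : ∀ a ∈ A.gr 0, ∀ m ∈ W, m ∈ A.gr 0 →
      a * m = proj W hn ((proj W hn a : A) * m) ∧ m * a = proj W hn (m * (proj W hn a : A))) :
    (compress W hW hn hassoc).EvenPartSemisimple := by
  set C := compress W hW hn hassoc
  set ι : C →ₗ[K] A := compressIncl W hW hn hassoc
  have hinj : Function.Injective ι := compressIncl_injective W hW hn hassoc
  have hproj : ∀ x : C, (proj W hn (ι x) : A) = ι x := fun x =>
    proj_of_mem hn (compressIncl_mem W hW hn hassoc x)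
  have hmul : ∀ a ∈ C.gr 0, ∀ m ∈ C.gr 0, ι (a * m) = ι a * ι m := by
    intro a ha m hm
    have := (h (ι a) ha (ι m) (compressIncl_mem W hW hn hassoc m) hm).1
    rw [hproj] at this
    exact this.symm
  intro M hM
  obtain ⟨N, ⟨hN0, hN⟩, hinf, hsup⟩ := hss (M.map ι) (by
    refine ⟨?_, ?_⟩
    · rintro _ ⟨m, hm, rfl⟩
      exact hM.1 hm
    · rintro a ha _ ⟨m, hm, rfl⟩
      have hm0 := hM.1 hm
      obtain ⟨h1, h2⟩ := h a ha (ι m) (compressIncl_mem W hW hn hassoc m) hm0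
      -- On even elements of W, a acts exactly as its projection does, so a sub-bimodule of the
      -- compression is also stable under A_0.
      have ha' : compressProj W hW hn hassoc a ∈ C.gr 0 := proj_mem_gr hn hW ha
      obtain ⟨h3, h4⟩ := hM.2 _ ha' m hm
      rw [h1, h2]
      exact ⟨⟨_, h3, rfl⟩, ⟨_, h4, rfl⟩⟩)
  refine ⟨N.comap ι, ⟨fun x hx => hN0 hx, fun a ha m hm => ?_⟩, ?_, ?_⟩
  · have hm0 : m ∈ C.gr 0 := hN0 hm
    obtain ⟨h1, h2⟩ := hN (ι a) ha (ι m) hm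
    rw [Submodule.mem_comap, Submodule.mem_comap, hmul a ha m hm0, hmul m hm0 a ha]
    exact ⟨h1, h2⟩
  · rw [eq_bot_iff]
    rintro x ⟨hx, hx'⟩
    have : ι x ∈ M.map ι ⊓ N := ⟨⟨x, hx, rfl⟩, hx'⟩
    rw [hinf, Submodule.mem_bot] at this
    exact hinj (by rw [this, map_zero])
  · apply le_antisymm
    · exact sup_le hM.1 fun x hx => hN0 hx
    · intro x hx
      have hx' : ι x ∈ M.map ι ⊔ N := by rw [hsup]; exact hx
      obtain ⟨_, ⟨m, hm, rfl⟩, n, hn', hmn⟩ := Submodule.mem_sup.1 hx'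
      refine Submodule.mem_sup.2 ⟨m, hm, x - m, ?_, add_sub_cancel _ _⟩
      rw [Submodule.mem_comap, map_sub, ← hmn, add_sub_cancel_left]
      exact hn'

end compress

/-! ### Splitting off non-degenerate ideals. -/

/-- `I` is a two-sided ideal. -/
def IsIdeal (A : EvenSymmSuperalgebra.{u, v} K) (I : Submodule K A) : Prop :=
  ∀ (a : A), ∀ x ∈ I, a * x ∈ I ∧ x * a ∈ I

theorem IsIdeal.orth {I : Submodule K A} (hI : A.IsGraded I) (hid : A.IsIdeal I) :
    A.IsIdeal (A.orth I) := by
  intro a x hx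
  constructor
  · refine mem_orth_of_form_eq_zero hI fun y hy => ?_
    rw [← A.form_assoc]
    exact form_eq_zero_of_mem_orth hI (hid a y hy).2 hx
  · intro y hy
    rw [A.form_assoc]
    exact hx _ (hid a y hy).1

theorem IsIdeal.proj_assoc {I : Submodule K A} (hn : A.NondegenerateOn I) (hid : A.IsIdeal I) :
    ∀ x ∈ I, ∀ y ∈ I, ∀ z ∈ I,
      proj I hn ((proj I hn (x * y) : A) * z) = proj I hn (x * (proj I hn (y * z) : A)) := by
  intro x hx y hy z hz
  rw [proj_of_mem hn (hid x y hy).1, proj_of_mem hn (hid y z hz).1, mul_assoc]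

section ideal

variable {I : Submodule K A}

/-- A graded non-degenerate ideal as a superalgebra. -/
noncomputable def ofIdeal (hI : A.IsGraded I) (hn : A.NondegenerateOn I) (hid : A.IsIdeal I) :
    EvenSymmSuperalgebra.{u, v} K :=
  compress I hI hn (hid.proj_assoc hn)

/-- The inclusion of an ideal. -/
noncomputable def ofIdealIncl (hI : A.IsGraded I) (hn : A.NondegenerateOn I) (hid : A.IsIdeal I) :
    ofIdeal hI hn hid →ₗ[K] A :=
  compressIncl I hI hn (hid.proj_assoc hn)

theorem ofIdealIncl_mul (hI : A.IsGraded I) (hn : A.NondegenerateOn I) (hid : A.IsIdeal I)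
    (x y : ofIdeal hI hn hid) :
    ofIdealIncl hI hn hid (x * y) = ofIdealIncl hI hn hid x * ofIdealIncl hI hn hid y := by
  exact (compressIncl_mul I hI hn (hid.proj_assoc hn) x y).trans
    (proj_of_mem hn (hid _ _ (compressIncl_mem I hI hn (hid.proj_assoc hn) y)).1)

theorem ofIdealIncl_mem (hI : A.IsGraded I) (hn : A.NondegenerateOn I) (hid : A.IsIdeal I)
    (x : ofIdeal hI hn hid) : ofIdealIncl hI hn hid x ∈ I :=
  compressIncl_mem I hI hn (hid.proj_assoc hn) x

/-- Both I and its orthogonal are ideals, so the products lie in their intersection, which is zero.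
-/
theorem mul_eq_zero_of_mem_orth (hI : A.IsGraded I) (hn : A.NondegenerateOn I) (hid : A.IsIdeal I)
    {x y : A} (hx : x ∈ I) (hy : y ∈ A.orth I) : x * y = 0 ∧ y * x = 0 :=
  ⟨hn _ (hid y x hx).2 ((hid.orth hI x y hy).1), hn _ (hid y x hx).1 ((hid.orth hI x y hy).2)⟩

theorem evenPartSemisimple_ofIdeal (hI : A.IsGraded I) (hn : A.NondegenerateOn I)
    (hid : A.IsIdeal I) (hss : A.EvenPartSemisimple) :
    (ofIdeal hI hn hid).EvenPartSemisimple := by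
  refine evenPartSemisimple_compress I hI hn _ hss fun a _ m hm _ => ?_
  have hp : (proj I hn a : A) ∈ I := (proj I hn a).2
  rw [proj_of_mem hn (hid _ m hm).1, proj_of_mem hn (hid _ m hm).2]
  -- The component of a orthogonal to I kills I, so only its projection acts.
  obtain ⟨h1, h2⟩ := mul_eq_zero_of_mem_orth hI hn hid hm (sub_proj_mem hn a)
  rw [mul_sub, sub_eq_zero] at h1
  rw [sub_mul, sub_eq_zero] at h2
  exact ⟨h2, h1⟩

theorem isOrthogonalDirectSum_ofIdeal (hI : A.IsGraded I) (hn : A.NondegenerateOn I)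
    (hid : A.IsIdeal I) :
    IsOrthogonalDirectSum (ofIdeal hI hn hid)
      (ofIdeal (isGraded_orth hI) (nondegenerateOn_orth hn) (hid.orth hI)) A := by
  set ι := ofIdealIncl hI hn hid
  set ι' := ofIdealIncl (isGraded_orth hI) (nondegenerateOn_orth hn) (hid.orth hI)
  have hι : ∀ x, ι x ∈ I := ofIdealIncl_mem hI hn hid
  have hι' : ∀ x, ι' x ∈ A.orth I := ofIdealIncl_mem _ _ (hid.orth hI)
  refine ⟨Submodule.prodEquivOfIsCompl I (A.orth I) (isCompl_orth hn), ?_, ?_, ?_⟩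
  · rintro ⟨x, x'⟩ ⟨y, y'⟩
    change (ι x + ι' x') * (ι y + ι' y') = ι (x * y) + ι' (x' * y')
    rw [ofIdealIncl_mul, ofIdealIncl_mul, add_mul, mul_add, mul_add,
      (mul_eq_zero_of_mem_orth hI hn hid (hι x) (hι' y')).1,
      (mul_eq_zero_of_mem_orth hI hn hid (hι y) (hι' x')).2, add_zero, zero_add]
  · rintro ⟨x, x'⟩ ⟨y, y'⟩
    change A.form (ι x + ι' x') (ι y + ι' y') = A.form (ι x) (ι y) + A.form (ι' x') (ι' y')
    simp only [map_add, LinearMap.add_apply]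
    rw [form_eq_zero_of_mem_orth hI (hι x) (hι' y'), hι' x' _ (hι y), add_zero, zero_add]
  · rintro i ⟨x, x'⟩
    change ι x + ι' x' ∈ A.gr i ↔ ι x ∈ A.gr i ∧ ι' x' ∈ A.gr i
    refine ⟨fun h => ?_, fun h => add_mem h.1 h.2⟩
    have h1 := proj_mem_gr hn hI h
    rw [proj_eq hn (hι x) (by rw [add_sub_cancel_left]; exact hι' x')] at h1
    exact ⟨h1, by simpa using sub_mem h h1⟩

theorem finrank_orth_lt (hn : A.NondegenerateOn I) (h : I ≠ ⊥) :
    Module.finrank K (A.orth I) < Module.finrank K A := by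
  have h1 := Submodule.finrank_add_eq_of_isCompl (isCompl_orth hn)
  have h2 : Module.finrank K I ≠ 0 := fun h0 => h (Submodule.finrank_eq_zero.1 h0)
  omega

/-- If `A` contains a nonzero graded non-degenerate ideal in `O`, then the problem reduces to
superalgebras of smaller dimension. -/
theorem obtainedFromO_of_ideal (hss : A.EvenPartSemisimple)
    (ih : ∀ W : EvenSymmSuperalgebra.{u, v} K, Module.finrank K W < Module.finrank K A →
      W.EvenPartSemisimple → W.ObtainedFromO)
    (hI : A.IsGraded I) (hn : A.NondegenerateOn I) (hid : A.IsIdeal I) (h0 : I ≠ ⊥)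
    (hO : (ofIdeal hI hn hid).MemO) : A.ObtainedFromO :=
  .directSum _ _ A (.base _ hO)
    (ih _ (finrank_orth_lt hn h0) (evenPartSemisimple_ofIdeal _ _ _ hss))
    (isOrthogonalDirectSum_ofIdeal hI hn hid)

end ideal

end EvenSymmSuperalgebra

/-! ### Double extensions from an annihilating isotropic vector. -/

namespace EvenSymmSuperalgebra

open AssocSuperalgebra

variable {K : Type u} [Field K] {A : EvenSymmSuperalgebra.{u, v} K}

/-- A hyperbolic pair `f`, `e` of homogeneous elements of degree `ε` such that `f` annihilates
`A`. -/
structure IsAnnihilatorPair (A : EvenSymmSuperalgebra.{u, v} K) (ε : ZMod 2) (f e : A) : Prop where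
  f_mem : f ∈ A.gr ε
  e_mem : e ∈ A.gr ε
  f_mul : ∀ a, f * a = 0
  mul_f : ∀ a, a * f = 0
  form_f_f : A.form f f = 0
  form_f_e : A.form f e = 1
  form_e_e : A.form e e = 0
  form_sq : A.form (e * e) e = 0

namespace IsAnnihilatorPair

variable {ε : ZMod 2} {f e : A} (h : A.IsAnnihilatorPair ε f e)

theorem sign_mul_sign (i : ZMod 2) : ((-1 : K) ^ i.val) * (-1) ^ i.val = 1 := by
  rw [← mul_pow]; simp

theorem form_e_f (h : A.IsAnnihilatorPair ε f e) : A.form e f = (-1) ^ ε.val := by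
  rw [form_comm_of_mem h.e_mem, h.form_f_e, mul_one]

theorem form_f_mul (h : A.IsAnnihilatorPair ε f e) (a b : A) : A.form f (a * b) = 0 := by
  rw [← A.form_assoc, h.f_mul, map_zero, LinearMap.zero_apply]

theorem isGraded_span (h : A.IsAnnihilatorPair ε f e) :
    A.IsGraded (Submodule.span K {f, e}) := by
  refine isGraded_span_of_mem (i := ε) ?_
  rintro x (rfl | rfl)
  exacts [h.f_mem, h.e_mem]

theorem nondegenerateOn_span (h : A.IsAnnihilatorPair ε f e) :
    A.NondegenerateOn (Submodule.span K {f, e}) := by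
  intro x hx hx'
  obtain ⟨α, β, rfl⟩ := Submodule.mem_span_pair.1 hx
  have h1 := hx' e (Submodule.subset_span (by simp))
  have h2 := hx' f (Submodule.subset_span (by simp))
  simp only [map_add, map_smul, LinearMap.add_apply, LinearMap.smul_apply, smul_eq_mul, h.form_f_f,
    h.form_e_e, h.form_f_e, h.form_e_f, mul_zero, mul_one, add_zero, zero_add] at h1 h2
  rw [mul_eq_zero, or_iff_left (pow_ne_zero _ (neg_ne_zero.2 one_ne_zero))] at h2
  rw [h1, h2, zero_smul, zero_smul, add_zero]

/-- The orthogonal of the pair. -/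
def core (_ : A.IsAnnihilatorPair ε f e) : Submodule K A := A.orth (Submodule.span K {f, e})

theorem isGraded_core : A.IsGraded h.core := isGraded_orth h.isGraded_span

theorem nondegenerateOn_core : A.NondegenerateOn h.core :=
  nondegenerateOn_orth h.nondegenerateOn_span

theorem mem_core {x : A} : x ∈ h.core ↔ A.form f x = 0 ∧ A.form x e = 0 := by
  rw [form_eq_zero_comm h.f_mem]
  constructor
  · intro hx
    exact ⟨hx f (Submodule.subset_span (by simp)), hx e (Submodule.subset_span (by simp))⟩
  · rintro ⟨h1, h2⟩ y hy
    obtain ⟨α, β, rfl⟩ := Submodule.mem_span_pair.1 hy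
    rw [map_add, map_smul, map_smul, h1, h2, smul_zero, smul_zero, add_zero]

theorem proj_core (x : A) :
    (proj h.core h.nondegenerateOn_core x : A) = x - A.form x e • f - A.form f x • e := by
  refine proj_eq _ ((mem_core h).2 ⟨?_, ?_⟩) ?_
  · simp [h.form_f_f, h.form_f_e]
  · simp [h.form_e_e, h.form_f_e]
  · intro y hy
    refine form_eq_zero_of_mem_orth h.isGraded_span ?_ hy
    have : x - (x - A.form x e • f - A.form f x • e) = A.form x e • f + A.form f x • e := by abel
    rw [this]
    exact Submodule.mem_span_pair.2 ⟨_, _, rfl⟩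

/-- Since f annihilates A, associativity of the form makes every product orthogonal to f. A product
thus has no e-component, and projecting it removes only a multiple of f. -/
theorem proj_core_mul (x y : A) :
    (proj h.core h.nondegenerateOn_core (x * y) : A) = x * y - A.form (x * y) e • f := by
  rw [proj_core, h.form_f_mul, zero_smul, sub_zero]

/-- The multiple of f lost in the projection is killed by the next multiplication. This gives
associativity of the projected product, and it lets the identities for D and D* be read off from
associativity in A. -/
theorem proj_mul_mul (x y z : A) :
    (proj h.core h.nondegenerateOn_core (x * y) : A) * z = x * y * z := by
  rw [proj_core_mul, sub_mul, smul_mul_assoc, h.f_mul, smul_zero, sub_zero]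

theorem mul_proj_mul (x y z : A) :
    x * (proj h.core h.nondegenerateOn_core (y * z) : A) = x * (y * z) := by
  rw [proj_core_mul, mul_sub, mul_smul_comm, h.mul_f, smul_zero, sub_zero]

/-- The superalgebra of which `A` is a double extension. -/
noncomputable def base : EvenSymmSuperalgebra.{u, v} K :=
  compress h.core h.isGraded_core h.nondegenerateOn_core fun x _ y _ z _ => by
    rw [proj_mul_mul, mul_proj_mul, mul_assoc]

/-- The inclusion of the base. -/
noncomputable def incl : h.base →ₗ[K] A := compressIncl h.core _ _ _

/-- The projection to the base. -/
noncomputable def toBase : A →ₗ[K] h.base := compressProj h.core _ _ _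

theorem incl_injective : Function.Injective h.incl := compressIncl_injective h.core _ _ _

theorem incl_mem (x : h.base) : h.incl x ∈ h.core := compressIncl_mem h.core _ _ _ x

theorem form_f_incl (x : h.base) : A.form f (h.incl x) = 0 := (h.mem_core.1 (h.incl_mem x)).1

theorem form_incl_e (x : h.base) : A.form (h.incl x) e = 0 := (h.mem_core.1 (h.incl_mem x)).2

theorem form_incl_f (x : h.base) : A.form (h.incl x) f = 0 :=
  (form_eq_zero_comm h.f_mem).1 (h.form_f_incl x)

theorem form_e_incl (x : h.base) : A.form e (h.incl x) = 0 :=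
  (form_eq_zero_comm h.e_mem).2 (h.form_incl_e x)

theorem form_base (x y : h.base) : h.base.form x y = A.form (h.incl x) (h.incl y) := rfl

theorem mem_gr_base {i : ZMod 2} {x : h.base} : x ∈ h.base.gr i ↔ h.incl x ∈ A.gr i := Iff.rfl

theorem incl_toBase (x : A) : h.incl (h.toBase x) = x - A.form x e • f - A.form f x • e :=
  h.proj_core x

theorem toBase_mem {i : ZMod 2} {x : A} (hx : x ∈ A.gr i) : h.toBase x ∈ h.base.gr i :=
  proj_mem_gr h.nondegenerateOn_core h.isGraded_core hx

theorem base_mul (x y : h.base) : x * y = h.toBase (h.incl x * h.incl y) := rfl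

theorem incl_toBase_mul (x y : A) :
    h.incl (h.toBase (x * y)) = x * y - A.form (x * y) e • f := h.proj_core_mul x y

theorem incl_toBase_mul_mul (x y z : A) : h.incl (h.toBase (x * y)) * z = x * y * z :=
  h.proj_mul_mul x y z

theorem mul_incl_toBase_mul (x y z : A) : x * h.incl (h.toBase (y * z)) = x * (y * z) :=
  h.mul_proj_mul x y z

theorem form_toBase_left (x : A) (y : h.base) :
    h.base.form (h.toBase x) y = A.form x (h.incl y) :=
  form_proj_left h.nondegenerateOn_core x (h.incl_mem y)

theorem form_toBase_right (x : h.base) (y : A) :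
    h.base.form x (h.toBase y) = A.form (h.incl x) y :=
  form_proj_right h.nondegenerateOn_core h.isGraded_core (h.incl_mem x) y

theorem toBase_incl (x : h.base) : h.toBase (h.incl x) = x := by
  apply h.incl_injective
  rw [incl_toBase, form_incl_e, form_f_incl, zero_smul, zero_smul, sub_zero, sub_zero]

theorem toBase_f : h.toBase f = 0 := by
  apply h.incl_injective
  rw [incl_toBase, h.form_f_e, h.form_f_f, one_smul, zero_smul, sub_self, sub_zero, map_zero]

theorem toBase_e : h.toBase e = 0 := by
  apply h.incl_injective
  rw [incl_toBase, h.form_f_e, h.form_e_e, one_smul, zero_smul, sub_zero, sub_self, map_zero]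

theorem finrank_base_lt : Module.finrank K h.base < Module.finrank K A := by
  refine finrank_orth_lt h.nondegenerateOn_span fun h0 => ?_
  have : f = 0 := by
    rw [← Submodule.mem_bot K, ← h0]; exact Submodule.subset_span (by simp)
  have h1 := h.form_f_e
  rw [this, map_zero, LinearMap.zero_apply] at h1
  exact zero_ne_one h1

/-- Left multiplication by `e`, projected to the base. -/
noncomputable def leftMul : h.base →ₗ[K] h.base :=
  h.toBase ∘ₗ LinearMap.mulLeft K e ∘ₗ h.incl

/-- Right multiplication by `e`, projected to the base. -/
noncomputable def rightMul : h.base →ₗ[K] h.base :=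
  h.toBase ∘ₗ LinearMap.mulRight K e ∘ₗ h.incl

theorem leftMul_apply (x : h.base) : h.leftMul x = h.toBase (e * h.incl x) := rfl

theorem rightMul_apply (x : h.base) : h.rightMul x = h.toBase (h.incl x * e) := rfl

theorem isHomogeneousEnd_leftMul : h.base.IsHomogeneousEnd ε h.leftMul := fun i x hx => by
  rw [add_comm]
  exact h.toBase_mem (A.mul_mem ε i e (h.incl x) h.e_mem hx)

theorem isHomogeneousEnd_rightMul : h.base.IsHomogeneousEnd ε h.rightMul := fun i x hx =>
  h.toBase_mem (A.mul_mem i ε (h.incl x) e hx h.e_mem)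

theorem form_rightMul (x y : h.base) :
    h.base.form (h.rightMul x) y = h.base.form x (h.leftMul y) := by
  rw [rightMul_apply, form_toBase_left, leftMul_apply, form_toBase_right, A.form_assoc]

theorem leftMul_rightMul (x : h.base) : h.leftMul (h.rightMul x) = h.rightMul (h.leftMul x) := by
  rw [leftMul_apply, rightMul_apply, mul_incl_toBase_mul, rightMul_apply, leftMul_apply,
    incl_toBase_mul_mul, mul_assoc]

theorem leftMul_leftMul (x : h.base) : h.leftMul (h.leftMul x) = h.toBase (e * e) * x := by
  rw [leftMul_apply, leftMul_apply, mul_incl_toBase_mul, base_mul, incl_toBase_mul_mul, mul_assoc]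

theorem leftMul_mul (x y : h.base) : h.leftMul (x * y) = h.leftMul x * y := by
  rw [leftMul_apply, leftMul_apply, base_mul, base_mul, mul_incl_toBase_mul, incl_toBase_mul_mul,
    mul_assoc]

theorem leftMul_sq : h.leftMul (h.toBase (e * e)) = h.rightMul (h.toBase (e * e)) := by
  rw [leftMul_apply, rightMul_apply, mul_incl_toBase_mul, incl_toBase_mul_mul, mul_assoc]

/-- The linear equivalence between the space of the extension and `A`. -/
noncomputable def equiv : (K × h.base × K) ≃ₗ[K] A where
  toFun p := p.1 • f + h.incl p.2.1 + p.2.2 • e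
  map_add' p q := by
    simp only [Prod.fst_add, Prod.snd_add, map_add, add_smul]; abel
  map_smul' c p := by
    simp only [Prod.smul_fst, Prod.smul_snd, map_smul, smul_add, smul_eq_mul, mul_smul,
      RingHom.id_apply]
  -- Hyperbolic coordinates: since B(f,e) = 1 and f, e are isotropic, pairing with e on the right
  -- reads off the coefficient of f, and pairing with f on the left that of e.
  invFun a := (A.form a e, h.toBase a, A.form f a)
  left_inv p := by
    simp [h.form_f_e, h.form_f_f, h.form_e_e, h.form_f_incl, h.form_incl_e, h.toBase_f, h.toBase_e,
      h.toBase_incl]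
  right_inv a := by
    simp only [incl_toBase]; abel

theorem equiv_apply (p : K × h.base × K) :
    h.equiv p = p.1 • f + h.incl p.2.1 + p.2.2 • e := rfl

theorem mul_eq (x y : A) : x * y = A.form (x * y) e • f + h.incl (h.toBase (x * y)) := by
  rw [incl_toBase_mul, add_sub_cancel]

theorem isExtensionBy :
    h.base.IsExtensionBy A ε h.leftMul h.rightMul (h.toBase (e * e)) := by
  refine ⟨h.equiv, ?_, ?_, ?_⟩
  · rintro ⟨α, x, β⟩ ⟨α', y, β'⟩
    -- The f-coefficient of a product is its pairing with e. Moving e to the front costs the sign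
    -- (-1)^ε, which is the sign in `extMul`.
    have h1 : A.form (h.incl x * h.incl y) e = (-1) ^ ε.val * h.base.form (h.leftMul x) y := by
      have := form_comm_of_mem h.e_mem (h.incl x * h.incl y)
      rw [leftMul_apply, form_toBase_left, A.form_assoc e, this, ← mul_assoc, sign_mul_sign,
        one_mul]
    have h2 : A.form (h.incl x * e) e = h.base.form x (h.toBase (e * e)) := by
      rw [A.form_assoc, form_toBase_right]
    have h3 : A.form (e * h.incl y) e = (-1) ^ ε.val * h.base.form y (h.toBase (e * e)) := by
      have hee : e * e ∈ A.gr 0 := by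
        have := A.mul_mem ε ε e e h.e_mem h.e_mem
        rwa [CharTwo.add_self_eq_zero] at this
      have := form_comm_of_mem h.e_mem (e * h.incl y)
      rw [form_toBase_right, ← form_comm_of_even hee, A.form_assoc e e, this, ← mul_assoc,
        sign_mul_sign, one_mul]
    have e1 := h.mul_eq (h.incl x) (h.incl y)
    have e2 := h.mul_eq (h.incl x) e
    have e3 := h.mul_eq e (h.incl y)
    have e4 := h.mul_eq e e
    rw [h1, ← base_mul] at e1
    rw [h2, ← rightMul_apply] at e2
    rw [h3, ← leftMul_apply] at e3
    -- `form_sq` ensures that e e has no f-component, so that it equals its projection x₀.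
    rw [h.form_sq, zero_smul, zero_add] at e4
    generalize h.toBase (e * e) = x₀ at e2 e3 e4 ⊢
    simp only [equiv_apply, extMul, mul_add, add_mul, smul_mul_assoc, mul_smul_comm, h.f_mul,
      h.mul_f, smul_zero, zero_add, add_zero, map_add, map_smul, zero_smul, e1, e2, e3, e4]
    module
  · rintro ⟨α, x, β⟩ ⟨α', y, β'⟩
    simp only [equiv_apply, extForm, map_add, map_smul, LinearMap.add_apply, LinearMap.smul_apply,
      smul_eq_mul, h.form_f_f, h.form_f_e, h.form_e_e, h.form_e_f, h.form_f_incl, h.form_incl_e,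
      h.form_incl_f, h.form_e_incl, form_base]
    ring
  · rintro i ⟨α, x, β⟩
    rw [equiv_apply, mem_gr_base]
    dsimp only
    constructor
    · intro hi
      have hx : h.incl x ∈ A.gr i := by
        have := h.toBase_mem hi
        rwa [map_add, map_add, map_smul, map_smul, toBase_f, toBase_e, toBase_incl, smul_zero,
          smul_zero, zero_add, add_zero, mem_gr_base] at this
      refine ⟨hx, fun hne => ⟨?_, ?_⟩⟩
      · have := form_eq_zero_of_mem hne hi h.e_mem
        simpa [h.form_f_e, h.form_e_e, h.form_incl_e] using this
      · have := form_eq_zero_of_mem hne.symm h.f_mem hi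
        simpa [h.form_f_e, h.form_f_f, h.form_f_incl] using this
    · rintro ⟨hx, hne⟩
      by_cases hi : i = ε
      · subst hi
        exact add_mem (add_mem (Submodule.smul_mem _ _ h.f_mem) hx) (Submodule.smul_mem _ _ h.e_mem)
      · obtain ⟨rfl, rfl⟩ := hne hi
        simpa using hx

/-- With f and e odd, all of A_0 is orthogonal to them, so the base keeps the even part and its
product unchanged. -/
theorem evenPartSemisimple_base_of_odd {f e : A} (h : A.IsAnnihilatorPair 1 f e)
    (hss : A.EvenPartSemisimple) : h.base.EvenPartSemisimple := by
  have hle : ∀ a ∈ A.gr 0, a ∈ h.core := fun a ha =>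
    h.mem_core.2 ⟨form_eq_zero_of_mem (by decide) h.f_mem ha,
      form_eq_zero_of_mem (by decide) ha h.e_mem⟩
  refine evenPartSemisimple_compress _ _ _ _ hss fun a ha m _ hm => ?_
  have hn := h.nondegenerateOn_core
  have h1 : a * m ∈ A.gr 0 := A.mul_mem 0 0 a m ha hm
  have h2 : m * a ∈ A.gr 0 := A.mul_mem 0 0 m a hm ha
  rw [proj_of_mem hn (hle a ha), proj_of_mem hn (hle _ h1), proj_of_mem hn (hle _ h2)]
  exact ⟨rfl, rfl⟩

theorem isOddGeneralizedDoubleExtension [CharZero K] {f e : A} (h : A.IsAnnihilatorPair 1 f e) :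
    h.base.IsOddGeneralizedDoubleExtension A := by
  have hee : e * e ∈ A.gr 0 := A.mul_mem 1 1 e e h.e_mem h.e_mem
  refine ⟨h.leftMul, h.rightMul, h.toBase (e * e), h.isHomogeneousEnd_leftMul,
    h.isHomogeneousEnd_rightMul, h.form_rightMul, h.toBase_mem hee, ?_, h.leftMul_sq,
    h.leftMul_leftMul, h.leftMul_rightMul, h.leftMul_mul, h.isExtensionBy⟩
  rw [form_toBase_right, ← A.form_assoc, incl_toBase_mul_mul, A.form_assoc]
  -- By associativity B(e e, e e) equals both B(e, e(e e)) and B(e(e e), e). As e is odd, these are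
  -- opposite, so the value is zero.
  have h1 := form_comm_of_odd h.e_mem (e * (e * e))
  rw [← A.form_assoc, ← mul_assoc e e e, A.form_assoc (e * e)] at h1
  exact self_eq_neg.1 h1

theorem evenPartSemisimple_base_of_even {f e : A} (h : A.IsAnnihilatorPair 0 f e)
    (h0 : ∀ a ∈ A.gr 0, ∀ b ∈ A.gr 0, a * b = 0) (hss : A.EvenPartSemisimple) :
    h.base.EvenPartSemisimple := by
  refine evenPartSemisimple_compress _ _ _ _ hss fun a ha m _ hm => ?_
  have h1 := proj_mem_gr h.nondegenerateOn_core h.isGraded_core ha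
  rw [h0 a ha m hm, h0 m hm a ha, h0 _ h1 m hm, h0 m hm _ h1, map_zero]
  exact ⟨rfl, rfl⟩

/-- Here e is even and A_0 has null product, so e e = 0 and e kills A_0, including all products of
two odd elements. The conditions on D that require something to vanish all follow from this. -/
theorem isElementaryEvenDoubleExtension {f e : A} (h : A.IsAnnihilatorPair 0 f e)
    (h0 : ∀ a ∈ A.gr 0, ∀ b ∈ A.gr 0, a * b = 0) (hss : A.EvenPartSemisimple) :
    h.base.IsElementaryEvenDoubleExtension A := by
  have hee : e * e = 0 := h0 e h.e_mem e h.e_mem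
  refine ⟨h.evenPartSemisimple_base_of_even h0 hss, h.leftMul, h.rightMul,
    h.isHomogeneousEnd_leftMul, h.form_rightMul, ?_, ?_, h.leftMul_rightMul, ?_, ?_,
    fun x _ y _ => h.leftMul_mul x y, ?_⟩
  · intro x hx
    rw [leftMul_apply, h0 e h.e_mem (h.incl x) hx, map_zero]
  · intro x
    rw [leftMul_leftMul, hee, map_zero, zero_mul]
  · intro x hx y hy
    rw [← leftMul_mul, leftMul_apply, base_mul, mul_incl_toBase_mul,
      h0 e h.e_mem _ (A.mul_mem 1 1 (h.incl x) (h.incl y) hx hy), map_zero]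
  · intro x hx y _
    rw [leftMul_mul, leftMul_apply, h0 e h.e_mem (h.incl x) hx, map_zero, zero_mul]
  · have := h.isExtensionBy
    rwa [hee, map_zero] at this

end IsAnnihilatorPair

end EvenSymmSuperalgebra

/-! ### Minimal left ideals and idempotents of a semisimple even part. -/

namespace AssocSuperalgebra

variable {K : Type u} [Field K] {A : AssocSuperalgebra.{u, v} K}

/-- `L` is a left ideal of `A_0`. -/
def IsEvenLeftIdeal (A : AssocSuperalgebra.{u, v} K) (L : Submodule K A) : Prop :=
  L ≤ A.gr 0 ∧ ∀ a ∈ A.gr 0, ∀ l ∈ L, a * l ∈ L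

theorem even_mul_mem {a b : A} (ha : a ∈ A.gr 0) (hb : b ∈ A.gr 0) : a * b ∈ A.gr 0 :=
  A.mul_mem 0 0 a b ha hb

theorem exists_minimal_evenLeftIdeal {S : Submodule K A} (hS : A.IsEvenLeftIdeal S) (h0 : S ≠ ⊥) :
    ∃ L ≤ S, A.IsEvenLeftIdeal L ∧ L ≠ ⊥ ∧
      ∀ L' ≤ L, A.IsEvenLeftIdeal L' → L' ≠ ⊥ → L' = L := by
  obtain ⟨L, ⟨h1, h2, h3⟩, hmin⟩ := WellFounded.has_min
    (wellFounded_lt : WellFounded ((· < ·) : Submodule K A → Submodule K A → Prop))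
    {L | L ≤ S ∧ A.IsEvenLeftIdeal L ∧ L ≠ ⊥} ⟨S, le_rfl, hS, h0⟩
  exact ⟨L, h1, h2, h3, fun L' hL' h4 h5 =>
    eq_of_le_of_not_lt hL' (hmin L' ⟨hL'.trans h1, h4, h5⟩)⟩

/-- A left ideal of square zero of a semisimple even part is annihilated from the left. -/
theorem even_mul_eq_zero_of_sq_eq_zero (hss : A.EvenPartSemisimple) {L : Submodule K A}
    (hL : A.IsEvenLeftIdeal L) (h : ∀ x ∈ L, ∀ y ∈ L, x * y = 0) :
    ∀ a ∈ A.gr 0, ∀ l ∈ L, a * l = 0 := by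
  -- M is the left annihilator of L in A_0, a sub-bimodule because L is a left ideal; it contains L
  -- because L has square zero.
  let M : Submodule K A :=
    { carrier := {m | m ∈ A.gr 0 ∧ ∀ l ∈ L, m * l = 0}
      zero_mem' := ⟨zero_mem _, fun l _ => zero_mul l⟩
      add_mem' := fun ha hb => ⟨add_mem ha.1 hb.1, fun l hl => by
        rw [add_mul, ha.2 l hl, hb.2 l hl, add_zero]⟩
      smul_mem' := fun c x hx => ⟨Submodule.smul_mem _ c hx.1, fun l hl => by
        rw [smul_mul_assoc, hx.2 l hl, smul_zero]⟩ }
  have hLM : L ≤ M := fun x hx => ⟨hL.1 hx, h x hx⟩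
  obtain ⟨C, hC, hinf, hsup⟩ := hss M ⟨fun x hx => hx.1, fun a ha m hm =>
    ⟨⟨even_mul_mem ha hm.1, fun l hl => by rw [mul_assoc, hm.2 l hl, mul_zero]⟩,
      ⟨even_mul_mem hm.1 ha, fun l hl => by rw [mul_assoc, hm.2 _ (hL.2 a ha l hl)]⟩⟩⟩
  intro a ha l hl
  rw [← hsup] at ha
  obtain ⟨m, hm, c, hc, rfl⟩ := Submodule.mem_sup.1 ha
  -- The product c l lies in L, hence in M, and also in C because C is stable under right
  -- multiplication.
  have h1 : c * l ∈ M ⊓ C := ⟨hLM (hL.2 c (hC.1 hc) l hl), (hC.2 l (hL.1 hl) c hc).2⟩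
  rw [hinf, Submodule.mem_bot] at h1
  rw [add_mul, hm.2 l hl, h1, add_zero]

/-- The sub-bimodule Z of elements killed by A_0 from the left has a complement C, nonzero since A_0
A_0 ≠ 0. A minimal left ideal inside C with square zero would be contained in Z, contradicting Z ∩ C
= 0. -/
theorem exists_minimal_evenLeftIdeal_sq_ne_zero (hss : A.EvenPartSemisimple)
    (h : ∃ a ∈ A.gr 0, ∃ b ∈ A.gr 0, a * b ≠ 0) :
    ∃ L, A.IsEvenLeftIdeal L ∧ (∀ L' ≤ L, A.IsEvenLeftIdeal L' → L' ≠ ⊥ → L' = L) ∧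
      ∃ x ∈ L, ∃ y ∈ L, x * y ≠ 0 := by
  let Z : Submodule K A :=
    { carrier := {x | x ∈ A.gr 0 ∧ ∀ a ∈ A.gr 0, a * x = 0}
      zero_mem' := ⟨zero_mem _, fun a _ => mul_zero a⟩
      add_mem' := fun hx hy => ⟨add_mem hx.1 hy.1, fun a ha => by
        rw [mul_add, hx.2 a ha, hy.2 a ha, add_zero]⟩
      smul_mem' := fun c x hx => ⟨Submodule.smul_mem _ c hx.1, fun a ha => by
        rw [mul_smul_comm, hx.2 a ha, smul_zero]⟩ }
  obtain ⟨C, hC, hinf, hsup⟩ := hss Z ⟨fun x hx => hx.1, fun a ha x hx =>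
    ⟨by rw [hx.2 a ha]; exact zero_mem _,
      ⟨even_mul_mem hx.1 ha, fun b hb => by rw [← mul_assoc, hx.2 b hb, zero_mul]⟩⟩⟩
  have hC0 : C ≠ ⊥ := by
    rintro rfl
    obtain ⟨a, ha, b, hb, hab⟩ := h
    rw [sup_bot_eq] at hsup
    rw [← hsup] at hb
    exact hab (hb.2 a ha)
  obtain ⟨L, hLC, hL, hL0, hmin⟩ :=
    exists_minimal_evenLeftIdeal ⟨hC.1, fun a ha l hl => (hC.2 a ha l hl).1⟩ hC0
  refine ⟨L, hL, hmin, ?_⟩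
  by_contra! hsq
  apply hL0
  rw [eq_bot_iff, ← hinf]
  exact fun x hx => ⟨⟨hL.1 hx, fun a ha => even_mul_eq_zero_of_sq_eq_zero hss hL hsq a ha x hx⟩,
    hLC hx⟩

/-- The left ideal of all products `x * b` with `x` in a given left ideal. -/
theorem IsEvenLeftIdeal.map_mulRight {L : Submodule K A} (hL : A.IsEvenLeftIdeal L) {b : A}
    (hb : b ∈ A.gr 0) : A.IsEvenLeftIdeal (L.map (LinearMap.mulRight K b)) := by
  constructor
  · rintro _ ⟨x, hx, rfl⟩
    exact even_mul_mem (hL.1 hx) hb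
  · rintro a ha _ ⟨x, hx, rfl⟩
    exact ⟨a * x, hL.2 a ha x hx, mul_assoc a x b⟩

/-- The left ideal of the elements of a given left ideal on which right multiplication by `b` acts
as the scalar `c`. -/
theorem IsEvenLeftIdeal.inf_eigenspace {L : Submodule K A} (hL : A.IsEvenLeftIdeal L) (b : A)
    (c : K) : A.IsEvenLeftIdeal
      (L ⊓ LinearMap.ker (LinearMap.mulRight K b - c • LinearMap.id)) := by
  refine ⟨fun x hx => hL.1 hx.1, fun a ha x hx => ⟨hL.2 a ha x hx.1, ?_⟩⟩
  have : x * b - c • x = 0 := hx.2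
  change a * x * b - c • (a * x) = 0
  rw [mul_assoc, ← mul_smul_comm, ← mul_sub, this, mul_zero]

/-- A semisimple even part with nonzero product contains an idempotent `p` with
`p A_0 p = K p`. -/
theorem exists_even_idempotent [IsAlgClosed K] (hss : A.EvenPartSemisimple)
    (h : ∃ a ∈ A.gr 0, ∃ b ∈ A.gr 0, a * b ≠ 0) :
    ∃ p ∈ A.gr 0, p ≠ 0 ∧ p * p = p ∧ ∀ x ∈ A.gr 0, ∃ c : K, p * x * p = c • p := by
  obtain ⟨L, hL, hmin, l₁, hl₁, l₂, hl₂, hne⟩ := exists_minimal_evenLeftIdeal_sq_ne_zero hss h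
  -- Schur's argument: an eigenspace of a right multiplication on L is a left ideal, so by
  -- minimality it is zero or all of L.
  have heig : ∀ (b : A) (c : K), (∃ x ∈ L, x ≠ 0 ∧ x * b = c • x) → ∀ x ∈ L, x * b = c • x := by
    rintro b c ⟨x, hx, hx0, hxb⟩ y hy
    have := hmin _ inf_le_left (hL.inf_eigenspace b c)
      ((Submodule.ne_bot_iff _).2 ⟨x, ⟨hx, sub_eq_zero.2 hxb⟩, hx0⟩)
    rw [← this] at hy
    exact sub_eq_zero.1 hy.2
  -- By minimality L l₂ = L, so some p in L satisfies p l₂ = l₂; this p is the idempotent sought.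
  have hmap : L.map (LinearMap.mulRight K l₂) = L := by
    refine hmin _ ?_ (hL.map_mulRight (hL.1 hl₂))
      ((Submodule.ne_bot_iff _).2 ⟨_, ⟨l₁, hl₁, rfl⟩, hne⟩)
    rintro _ ⟨x, hx, rfl⟩
    exact hL.2 x (hL.1 hx) l₂ hl₂
  have hl₂' := hl₂
  rw [← hmap] at hl₂'
  obtain ⟨p, hp, hpl⟩ := hl₂'
  change p * l₂ = l₂ at hpl
  have hl₂0 : l₂ ≠ 0 := by rintro rfl; exact hne (mul_zero _)
  have hp0 : p ≠ 0 := by rintro rfl; exact hl₂0 (by rw [← hpl, zero_mul])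
  have hpp : p * p = p := by
    by_contra hpp
    -- The element p p - p is killed by l₂. Were it nonzero, L l₂ would vanish, contrary to l₁ l₂ ≠
    -- 0.
    have := heig l₂ 0 ⟨p * p - p, sub_mem (hL.2 p (hL.1 hp) p hp) hp, sub_ne_zero.2 hpp, by
      rw [sub_mul, mul_assoc, hpl, hpl, sub_self, zero_smul]⟩ l₁ hl₁
    rw [zero_smul] at this
    exact hne this
  refine ⟨p, hL.1 hp, hp0, hpp, fun x hx => ?_⟩
  have hw : ∀ z ∈ L, z * (p * x * p) ∈ L := fun z hz =>
    by
      rw [← mul_assoc]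
      exact hL.2 _ (even_mul_mem (hL.1 hz) (even_mul_mem (hL.1 hp) hx)) p hp
  -- An eigenvalue c of right multiplication by p x p makes it the scalar c on all of L; evaluating
  -- at p gives p x p = c p.
  let T : Module.End K L := (LinearMap.mulRight K (p * x * p)).restrict hw
  have : Nontrivial L := ⟨⟨⟨p, hp⟩, 0, fun h => hp0 (congrArg Subtype.val h)⟩⟩
  obtain ⟨c, hc⟩ := Module.End.exists_eigenvalue T
  obtain ⟨z, hz⟩ := hc.exists_hasEigenvector
  refine ⟨c, ?_⟩
  have := heig (p * x * p) c ⟨z, z.2, fun h => hz.2 (Subtype.ext h),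
    congrArg Subtype.val hz.apply_eq_smul⟩ p hp
  rwa [← mul_assoc, ← mul_assoc, hpp] at this

end AssocSuperalgebra

/-! ### The corner of a primitive even idempotent. -/

namespace EvenSymmSuperalgebra

open AssocSuperalgebra

variable {K : Type u} [Field K] {A : EvenSymmSuperalgebra.{u, v} K}

/-- `p` is a nonzero even idempotent with `p A_0 p = K p`. -/
structure IsPrimitiveEven (A : EvenSymmSuperalgebra.{u, v} K) (p : A) : Prop where
  mem : p ∈ A.gr 0
  ne_zero : p ≠ 0
  mul_self : p * p = p
  even_corner : ∀ x ∈ A.gr 0, ∃ c : K, p * x * p = c • p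

namespace IsPrimitiveEven

variable {p : A}

theorem form_corner (hp : A.IsPrimitiveEven p) (x y : A) :
    A.form (p * x * p) y = A.form (p * x * p) (p * y * p) := by
  have h1 : p * x * p = p * (p * x * p) * p := by
    simp only [mul_assoc, hp.mul_self]; simp only [← mul_assoc, hp.mul_self]
  conv_lhs => rw [h1]
  rw [A.form_assoc, form_even_mul hp.mem]

/-- For even y, B(p,y) = B(p, p y p) is a multiple of B(p,p), and for odd y it vanishes; so B(p,p) =
0 would put p in the radical. -/
theorem form_self_ne_zero (hp : A.IsPrimitiveEven p) : A.form p p ≠ 0 := by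
  intro h0
  apply hp.ne_zero
  refine A.form_nondegenerate p fun y => ?_
  induction y using homogeneous_induction with
  | h i y hy =>
    rcases zmod_two_cases i with rfl | rfl
    · obtain ⟨c, hc⟩ := hp.even_corner y hy
      have := hp.form_corner p y
      rw [hp.mul_self, hp.mul_self, hc, map_smul, h0, smul_zero] at this
      exact this
    · exact form_eq_zero_of_mem (by decide) hp.mem hy
  | hadd x y hx hy => rw [map_add, hx, hy, add_zero]

/-- Put u = p x p. Then u u is a multiple of p detected by B(u,u), which is zero since u is odd;
hence u u = 0. If u v = c p for v in the odd corner, then c u = u u v = 0, so c = 0 or u = 0, and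
either way B(u,v) = 0. Thus u is in the radical. This excludes the simple superalgebras of queer
type. -/
theorem odd_corner [CharZero K] (hp : A.IsPrimitiveEven p) {x : A} (hx : x ∈ A.gr 1) :
    p * x * p = 0 := by
  have hodd : ∀ y ∈ A.gr 1, p * y * p ∈ A.gr 1 := fun y hy =>
    A.mul_mem 1 0 (p * y) p (A.mul_mem 0 1 p y hp.mem hy) hp.mem
  have hprod : ∀ y ∈ A.gr 1, ∃ c : K, (p * x * p) * (p * y * p) = c • p := by
    intro y hy
    obtain ⟨c, hc⟩ := hp.even_corner (x * p * (p * y))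
      (A.mul_mem 1 1 (x * p) (p * y) (A.mul_mem 1 0 x p hx hp.mem) (A.mul_mem 0 1 p y hp.mem hy))
    exact ⟨c, by rw [← hc]; simp only [mul_assoc]⟩
  have hpr : (p * x * p) * p = p * x * p := by rw [mul_assoc, hp.mul_self]
  have hform : ∀ y c, (p * x * p) * (p * y * p) = c • p →
      A.form (p * x * p) (p * y * p) = c * A.form p p := by
    intro y c hc
    have h1 : p * y * p = (p * y * p) * p := by rw [mul_assoc (p * y), hp.mul_self]
    rw [h1, ← A.form_assoc, hc, map_smul, LinearMap.smul_apply, smul_eq_mul]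
  have hsq : (p * x * p) * (p * x * p) = 0 := by
    obtain ⟨c, hc⟩ := hprod x hx
    have h1 := hform x c hc
    have h2 := form_comm_of_odd (hodd x hx) (p * x * p)
    rw [self_eq_neg.1 h2, eq_comm, mul_eq_zero, or_iff_left hp.form_self_ne_zero] at h1
    rw [hc, h1, zero_smul]
  refine A.form_nondegenerate _ fun y => ?_
  induction y using homogeneous_induction with
  | h i y hy =>
    rcases zmod_two_cases i with rfl | rfl
    · exact form_eq_zero_of_mem (by decide) (hodd x hx) hy
    · obtain ⟨c, hc⟩ := hprod y hy
      rw [hp.form_corner, hform y c hc]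
      have : c • (p * x * p) = 0 := by
        rw [← hpr, ← mul_smul_comm, ← hc, ← mul_assoc, hsq, zero_mul]
      rcases smul_eq_zero.1 this with rfl | h
      · rw [zero_mul]
      · rw [h, zero_mul] at hc
        rw [(smul_eq_zero.1 hc.symm).resolve_right hp.ne_zero, zero_mul]
  | hadd x y hx hy => rw [map_add, hx, hy, add_zero]

theorem corner [CharZero K] (hp : A.IsPrimitiveEven p) (x : A) : ∃ c : K, p * x * p = c • p := by
  obtain ⟨a, ha, b, hb, rfl⟩ := A.exists_add_eq x
  obtain ⟨c, hc⟩ := hp.even_corner a ha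
  exact ⟨c, by rw [mul_add, add_mul, hc, hp.odd_corner hb, add_zero]⟩

end IsPrimitiveEven

end EvenSymmSuperalgebra

/-! ### The matrix superalgebra generated by a primitive even idempotent. -/

namespace EvenSymmSuperalgebra

open AssocSuperalgebra

variable {K : Type u} [Field K] {A : EvenSymmSuperalgebra.{u, v} K}

/-- The parity of an index of `M_{r,s}(K)`. -/
def parity {r s : ℕ} : Fin r ⊕ Fin s → ZMod 2 := Sum.elim (fun _ => 0) (fun _ => 1)

theorem mem_matrixGr_iff {r s : ℕ} {i : ZMod 2} {M : Matrix (Fin r ⊕ Fin s) (Fin r ⊕ Fin s) K} :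
    M ∈ matrixGr K r s i ↔ ∀ k l, parity k + parity l ≠ i → M k l = 0 := by
  rcases zmod_two_cases i with rfl | rfl
  · rw [mem_matrixGr_zero]
    constructor
    · rintro ⟨h1, h2⟩ (k | k) (l | l) hkl
      · exact absurd (by simp [parity]) hkl
      · exact congrFun (congrFun h1 k) l
      · exact congrFun (congrFun h2 k) l
      · exact absurd (by simp [parity, CharTwo.add_self_eq_zero]) hkl
    · intro h
      exact ⟨by ext k l; exact h _ _ (by simp [parity]), by ext k l; exact h _ _ (by simp [parity])⟩
  · rw [mem_matrixGr_one]
    constructor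
    · rintro ⟨h1, h2⟩ (k | k) (l | l) hkl
      · exact congrFun (congrFun h1 k) l
      · exact absurd (by simp [parity]) hkl
      · exact absurd (by simp [parity]) hkl
      · exact congrFun (congrFun h2 k) l
    · intro h
      exact ⟨by ext k l; exact h _ _ (by simp [parity]),
        by ext k l; exact h _ _ (by simp [parity])⟩

/-- Dual homogeneous bases `x` of `A p` and `y` of `p A`. -/
structure IsFrame (A : EvenSymmSuperalgebra.{u, v} K) (p : A) {r s : ℕ}
    (x y : Fin r ⊕ Fin s → A) : Prop where
  x_mem : ∀ i, x i ∈ A.gr (parity i)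
  y_mem : ∀ i, y i ∈ A.gr (parity i)
  x_mul : ∀ i, x i * p = x i
  mul_y : ∀ i, p * y i = y i
  y_mul_x : ∀ j i, y j * x i = if j = i then p else 0
  mem_span_x : ∀ u, u * p = u → u ∈ Submodule.span K (Set.range x)
  mem_span_y : ∀ v, p * v = v → v ∈ Submodule.span K (Set.range y)

theorem exists_form_eq (A : EvenSymmSuperalgebra.{u, v} K) (f : Module.Dual K A) :
    ∃ y : A, ∀ a, A.form y a = f a := by
  have hinj : Function.Injective A.form := by
    rw [← LinearMap.ker_eq_bot, LinearMap.ker_eq_bot']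
    exact fun m hm => A.form_nondegenerate m fun y => LinearMap.congr_fun hm y
  have hsurj : Function.Surjective (A.form : A →ₗ[K] Module.Dual K A) :=
    (LinearMap.injective_iff_surjective_of_finrank_eq_finrank
      Subspace.dual_finrank_eq.symm).1 hinj
  obtain ⟨y, hy⟩ := hsurj f
  exact ⟨y, fun a => LinearMap.congr_fun hy a⟩

theorem exists_dual_of_linearIndependent {V ι : Type*} [AddCommGroup V] [Module K V] [Fintype ι]
    [DecidableEq ι] {x : ι → V} (hx : LinearIndependent K x) (j : ι) :
    ∃ f : Module.Dual K V, ∀ i, f (x i) = if j = i then 1 else 0 := by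
  obtain ⟨g, hg⟩ := LinearMap.exists_leftInverse_of_injective (Fintype.linearCombination K x)
    (LinearMap.ker_eq_bot.2 (linearIndependent_iff_injective_fintypeLinearCombination.1 hx))
  refine ⟨LinearMap.proj j ∘ₗ g, fun i => ?_⟩
  have h1 := LinearMap.congr_fun hg (Pi.single i 1)
  rw [LinearMap.comp_apply, Fintype.linearCombination_apply_single, one_smul] at h1
  rw [LinearMap.comp_apply, h1]
  simp [Pi.single_apply]

namespace IsPrimitiveEven

variable {p : A}

/-- The homogeneous components of `A p`. -/
def column (A : EvenSymmSuperalgebra.{u, v} K) (p : A) (i : ZMod 2) : Submodule K A :=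
  A.gr i ⊓ LinearMap.ker (LinearMap.mulRight K p - LinearMap.id)

theorem mem_column {i : ZMod 2} {u : A} : u ∈ column A p i ↔ u ∈ A.gr i ∧ u * p = u := by
  rw [column, Submodule.mem_inf, LinearMap.mem_ker, LinearMap.sub_apply, sub_eq_zero]
  rfl

theorem exists_column_basis (hp : A.IsPrimitiveEven p) :
    ∃ (r s : ℕ) (x : Fin r ⊕ Fin s → A), 1 ≤ r ∧ LinearIndependent K x ∧
      (∀ i, x i ∈ A.gr (parity i)) ∧ (∀ i, x i * p = x i) ∧
      ∀ u, u * p = u → u ∈ Submodule.span K (Set.range x) := by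
  let b₀ := Module.finBasis K (column A p 0)
  let b₁ := Module.finBasis K (column A p 1)
  have hspan : ∀ k (u : A), u ∈ column A p k → u ∈ Submodule.span K
      (Set.range ((column A p k).subtype ∘ Module.finBasis K (column A p k))) := by
    intro k u hu
    rw [Set.range_comp, Submodule.span_image, (Module.finBasis K (column A p k)).span_eq]
    exact ⟨⟨u, hu⟩, trivial, rfl⟩
  have hle : ∀ k, Submodule.span K
      (Set.range ((column A p k).subtype ∘ Module.finBasis K (column A p k))) ≤ A.gr k := by
    intro k
    rw [Submodule.span_le]
    rintro _ ⟨i, rfl⟩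
    exact (mem_column.1 (Subtype.property _)).1
  refine ⟨_, _, Sum.elim ((column A p 0).subtype ∘ b₀) ((column A p 1).subtype ∘ b₁), ?_, ?_,
    ?_, ?_, ?_⟩
  -- The even part of Ap contains p, whence r ≥ 1.
  · rw [Nat.one_le_iff_ne_zero]
    intro h0
    rw [Submodule.finrank_eq_zero] at h0
    have : p ∈ column A p 0 := mem_column.2 ⟨hp.mem, hp.mul_self⟩
    rw [h0] at this
    exact hp.ne_zero this
  · refine LinearIndependent.sum_type ?_ ?_ (A.isCompl_gr.disjoint.mono (hle 0) (hle 1))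
    · exact b₀.linearIndependent.map' _ (Submodule.ker_subtype _)
    · exact b₁.linearIndependent.map' _ (Submodule.ker_subtype _)
  · rintro (i | i)
    · exact (mem_column.1 (b₀ i).2).1
    · exact (mem_column.1 (b₁ i).2).1
  · rintro (i | i)
    · exact (mem_column.1 (b₀ i).2).2
    · exact (mem_column.1 (b₁ i).2).2
  · intro u hu
    obtain ⟨a, ha, b, hb, rfl⟩ := A.exists_add_eq u
    rw [Set.Sum.elim_range, Submodule.span_union]
    have h : (a * p - a) + (b * p - b) = 0 := by
      rw [add_mul] at hu
      rw [sub_add_sub_comm, hu, sub_self]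
    obtain ⟨h1, h2⟩ := eq_zero_of_add_eq_zero (sub_mem (A.mul_mem 0 0 a p ha hp.mem) ha)
      (sub_mem (A.mul_mem 1 0 b p hb hp.mem) hb) h
    exact add_mem (Submodule.mem_sup_left (hspan 0 a (mem_column.2 ⟨ha, sub_eq_zero.1 h1⟩)))
      (Submodule.mem_sup_right (hspan 1 b (mem_column.2 ⟨hb, sub_eq_zero.1 h2⟩)))

/-- Multiplication pairs pA with Ap into p A p = K p, and B(·, p) identifies this pairing with the
restriction of B because B(p,p) ≠ 0. The dual basis of a homogeneous basis of Ap therefore exists in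
pA. -/
theorem exists_frame [CharZero K] (hp : A.IsPrimitiveEven p) :
    ∃ (r s : ℕ) (x y : Fin r ⊕ Fin s → A), 1 ≤ r ∧ A.IsFrame p x y := by
  obtain ⟨r, s, x, hr, hli, hx, hxp, hspan⟩ := hp.exists_column_basis
  have hy : ∀ j, ∃ y ∈ A.gr (parity j), p * y = y ∧ ∀ i, y * x i = if j = i then p else 0 := by
    intro j
    obtain ⟨f, hf⟩ := exists_dual_of_linearIndependent hli j
    -- The factor B(p,p) normalizes y_j x_j to p itself. Only the component of z with the parity of
    -- x_j is kept below; this makes y_j homogeneous without changing the pairings that matter.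
    obtain ⟨z, hz⟩ := A.exists_form_eq (A.form p p • f)
    obtain ⟨t, ht, t', k, hk, ht', rfl⟩ : ∃ t ∈ A.gr (parity j), ∃ t', ∃ k ≠ parity j,
        t' ∈ A.gr k ∧ t + t' = z := by
      obtain ⟨a, ha, b, hb, hab⟩ := A.exists_add_eq z
      rcases zmod_two_cases (parity j) with h | h
      · exact ⟨a, h ▸ ha, b, 1, by rw [h]; decide, hb, hab⟩
      · exact ⟨b, h ▸ hb, a, 0, by rw [h]; decide, ha, by rw [add_comm, hab]⟩
    have hform : ∀ i, A.form t (x i) = if j = i then A.form p p else 0 := by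
      intro i
      by_cases hij : parity j = parity i
      · have h1 := hz (x i)
        rw [map_add, LinearMap.add_apply, form_eq_zero_of_mem (hij ▸ hk) ht' (hx i), add_zero,
          LinearMap.smul_apply, hf] at h1
        rw [h1]
        simp
      · rw [form_eq_zero_of_mem hij ht (hx i), if_neg (fun h => hij (congrArg _ h))]
    refine ⟨p * t, by simpa using A.mul_mem 0 _ p t hp.mem ht, by rw [← mul_assoc, hp.mul_self],
      fun i => ?_⟩
    have h1 : p * t * x i = p * (t * x i) * p := by simp only [mul_assoc, hxp]
    obtain ⟨c, hc⟩ := hp.corner (t * x i)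
    have h2 : A.form (p * t * x i) p = A.form t (x i) := by
      rw [A.form_assoc, hxp, form_even_mul hp.mem, hxp]
    rw [h1, hc, map_smul, LinearMap.smul_apply, hform, smul_eq_mul] at h2
    rw [h1, hc]
    split_ifs at h2 ⊢
    · rw [(mul_eq_right₀ hp.form_self_ne_zero).1 h2, one_smul]
    · rw [(mul_eq_zero.1 h2).resolve_right hp.form_self_ne_zero, zero_smul]
  choose y hy hpy hyx using hy
  refine ⟨r, s, x, y, hr, hx, hy, hxp, hpy, hyx, hspan, fun v hv => ?_⟩
  have hc : ∀ i, ∃ c : K, v * x i = c • p := fun i => by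
    obtain ⟨c, hc⟩ := hp.corner (v * x i)
    refine ⟨c, ?_⟩
    rw [← hc, mul_assoc p, mul_assoc v, hxp, ← mul_assoc, hv]
  choose c hc using hc
  -- The difference w satisfies p w = w and kills Ap, so B(w,a) = B(w, a p) = B(w (a p), p) = 0 for
  -- every a.
  have hw : v - ∑ j, c j • y j = 0 := by
    set w := v - ∑ j, c j • y j
    have hpw : p * w = w := by
      simp only [w, mul_sub, hv, Finset.mul_sum, mul_smul_comm, hpy]
    have hwx : ∀ i, w * x i = 0 := by
      intro i
      simp [-Fintype.sum_sum_type, w, sub_mul, hc, Finset.sum_mul, smul_mul_assoc, hyx]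
    have hwu : Submodule.span K (Set.range x) ≤ LinearMap.ker (LinearMap.mulLeft K w) := by
      rw [Submodule.span_le]
      rintro _ ⟨i, rfl⟩
      exact hwx i
    refine A.form_nondegenerate w fun a => ?_
    have hap : a * p * p = a * p := by rw [mul_assoc, hp.mul_self]
    have h0 : w * (a * p) = 0 := hwu (hspan _ hap)
    rw [← hpw, form_even_mul hp.mem, ← hap, ← A.form_assoc, h0, map_zero, LinearMap.zero_apply]
  rw [sub_eq_zero.1 hw]
  exact sum_mem fun j _ => Submodule.smul_mem _ _ (Submodule.subset_span ⟨j, rfl⟩)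

end IsPrimitiveEven

namespace IsFrame

variable {p : A} {r s : ℕ} {x y : Fin r ⊕ Fin s → A}

/-- The linear map that sends the matrix units to the products `x i * y j`. -/
def ofMatrix (x y : Fin r ⊕ Fin s → A) : Matrix (Fin r ⊕ Fin s) (Fin r ⊕ Fin s) K →ₗ[K] A where
  toFun M := ∑ i, ∑ j, M i j • (x i * y j)
  map_add' M N := by simp only [Matrix.add_apply, add_smul, Finset.sum_add_distrib]
  map_smul' c M := by
    simp only [Matrix.smul_apply, smul_eq_mul, mul_smul, Finset.smul_sum, RingHom.id_apply]

theorem ofMatrix_apply (M : Matrix (Fin r ⊕ Fin s) (Fin r ⊕ Fin s) K) :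
    ofMatrix x y M = ∑ i, ∑ j, M i j • (x i * y j) := rfl

theorem ofMatrix_mul_x (h : A.IsFrame p x y) (M : Matrix (Fin r ⊕ Fin s) (Fin r ⊕ Fin s) K)
    (l : Fin r ⊕ Fin s) : ofMatrix x y M * x l = ∑ i, M i l • x i := by
  simp [-Fintype.sum_sum_type, ofMatrix_apply, Finset.sum_mul, smul_mul_assoc, mul_assoc, h.y_mul_x, h.x_mul]

theorem y_mul_ofMatrix_mul_x (h : A.IsFrame p x y)
    (M : Matrix (Fin r ⊕ Fin s) (Fin r ⊕ Fin s) K) (k l : Fin r ⊕ Fin s) :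
    y k * (ofMatrix x y M * x l) = M k l • p := by
  simp [-Fintype.sum_sum_type, h.ofMatrix_mul_x, Finset.mul_sum, mul_smul_comm, h.y_mul_x]

/-- The products x_i y_j multiply as matrix units, because y_j x_k = δ_jk p and x_i p = x_i. -/
theorem ofMatrix_mul (h : A.IsFrame p x y) (M N : Matrix (Fin r ⊕ Fin s) (Fin r ⊕ Fin s) K) :
    ofMatrix x y (M * N) = ofMatrix x y M * ofMatrix x y N := by
  rw [ofMatrix_apply N]
  simp only [Finset.mul_sum, mul_smul_comm, ← mul_assoc, h.ofMatrix_mul_x]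
  simp only [ofMatrix_apply, Matrix.mul_apply, Finset.sum_smul, Finset.sum_mul, Finset.smul_sum,
    smul_mul_assoc, smul_smul]
  rw [Finset.sum_congr rfl fun i _ => Finset.sum_comm, Finset.sum_comm]
  refine Finset.sum_congr rfl fun k _ => ?_
  rw [Finset.sum_comm]
  refine Finset.sum_congr rfl fun l _ => Finset.sum_congr rfl fun i _ => ?_
  rw [mul_comm]

/-- Sandwiching the image between y_k and x_l recovers the entry at (k,l) as a coefficient of p. -/
theorem ofMatrix_injective (h : A.IsFrame p x y) (hp : p ≠ 0) :
    Function.Injective (ofMatrix x y) := by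
  rw [← LinearMap.ker_eq_bot, LinearMap.ker_eq_bot']
  intro M hM
  ext k l
  have := h.y_mul_ofMatrix_mul_x M k l
  rw [hM, zero_mul, mul_zero] at this
  exact (smul_eq_zero.1 this.symm).resolve_right hp

theorem ofMatrix_mem_gr_iff (h : A.IsFrame p x y) (hp : p ≠ 0) (hp0 : p ∈ A.gr 0) {i : ZMod 2}
    {M : Matrix (Fin r ⊕ Fin s) (Fin r ⊕ Fin s) K} :
    ofMatrix x y M ∈ A.gr i ↔ M ∈ matrixGr K r s i := by
  rw [mem_matrixGr_iff]
  constructor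
  · intro hM k l hkl
    have h1 := A.mul_mem _ _ _ _ (h.y_mem k) (A.mul_mem _ _ _ _ hM (h.x_mem l))
    rw [h.y_mul_ofMatrix_mul_x] at h1
    have h2 : (0 : ZMod 2) ≠ parity k + (i + parity l) := by
      intro h0
      apply hkl
      generalize parity k = a at *
      generalize parity l = b at *
      clear * - h0
      revert a b i
      decide
    exact (smul_eq_zero.1 (eq_zero_of_mem_gr h2 (Submodule.smul_mem _ _ hp0) h1)).resolve_right hp
  · intro hM
    rw [ofMatrix_apply]
    refine sum_mem fun k _ => sum_mem fun l _ => ?_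
    by_cases hkl : parity k + parity l = i
    · exact Submodule.smul_mem _ _ (hkl ▸ A.mul_mem _ _ _ _ (h.x_mem k) (h.y_mem l))
    · rw [hM k l hkl, zero_smul]
      exact zero_mem _

theorem mul_mem_range (h : A.IsFrame p x y) {u v : A} (hu : u * p = u) (hv : p * v = v) :
    u * v ∈ LinearMap.range (ofMatrix x y) := by
  obtain ⟨c, rfl⟩ := (Submodule.mem_span_range_iff_exists_fun K).1 (h.mem_span_x u hu)
  obtain ⟨d, rfl⟩ := (Submodule.mem_span_range_iff_exists_fun K).1 (h.mem_span_y v hv)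
  refine ⟨Matrix.of fun i j => c i * d j, ?_⟩
  simp only [ofMatrix_apply, Matrix.of_apply, Finset.sum_mul, Finset.mul_sum, smul_mul_assoc,
    mul_smul_comm]
  rw [Finset.sum_comm]
  refine Finset.sum_congr rfl fun j _ => ?_
  rw [Finset.smul_sum]
  exact Finset.sum_congr rfl fun i _ => by rw [smul_smul, mul_comm]

/-- The range is the span of Ap · pA, and Ap and pA are one-sided ideals. -/
theorem isIdeal_range (h : A.IsFrame p x y) : A.IsIdeal (LinearMap.range (ofMatrix x y)) := by
  rintro a _ ⟨M, rfl⟩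
  rw [ofMatrix_apply]
  simp only [Finset.sum_mul, Finset.mul_sum, smul_mul_assoc, mul_smul_comm]
  constructor
  · refine sum_mem fun i _ => sum_mem fun j _ => Submodule.smul_mem _ _ ?_
    rw [← mul_assoc]
    exact h.mul_mem_range (by rw [mul_assoc, h.x_mul]) (h.mul_y j)
  · refine sum_mem fun i _ => sum_mem fun j _ => Submodule.smul_mem _ _ ?_
    rw [mul_assoc]
    exact h.mul_mem_range (h.x_mul i) (by rw [← mul_assoc, h.mul_y])

theorem isGraded_range (h : A.IsFrame p x y) (hp : p ≠ 0) (hp0 : p ∈ A.gr 0) :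
    A.IsGraded (LinearMap.range (ofMatrix x y)) := by
  rintro a ha b hb ⟨M, hM⟩
  have hM' : M ∈ matrixGr K r s 0 ⊔ matrixGr K r s 1 := by
    rw [(matrixGr_isCompl K r s).sup_eq_top]; trivial
  obtain ⟨M₀, h₀, M₁, h₁, rfl⟩ := Submodule.mem_sup.1 hM'
  rw [← h.ofMatrix_mem_gr_iff hp hp0] at h₀ h₁
  rw [map_add, ← sub_eq_zero, add_sub_add_comm] at hM
  obtain ⟨e₀, e₁⟩ := eq_zero_of_add_eq_zero (sub_mem h₀ ha) (sub_mem h₁ hb) hM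
  exact ⟨⟨M₀, sub_eq_zero.1 e₀⟩, ⟨M₁, sub_eq_zero.1 e₁⟩⟩

/-- Pairing with the matrix unit x_l y_k isolates the entry at (k,l), up to the nonzero factor
±B(p,p). -/
theorem nondegenerateOn_range (h : A.IsFrame p x y) (hp : A.form p p ≠ 0) :
    A.NondegenerateOn (LinearMap.range (ofMatrix x y)) := by
  rintro _ ⟨M, rfl⟩ hM
  suffices M = 0 by rw [this, map_zero]
  ext k l
  have h1 := hM (x l * y k) (h.mul_mem_range (h.x_mul l) (h.mul_y k))
  rw [← A.form_assoc, h.ofMatrix_mul_x, map_sum, LinearMap.sum_apply] at h1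
  have h2 : ∀ i, A.form (x i) (y k) = if k = i then (-1) ^ (parity i).val * A.form p p else 0 := by
    intro i
    rw [form_comm_of_mem (h.x_mem i), ← h.x_mul i, ← A.form_assoc, h.y_mul_x]
    split_ifs <;> simp
  simpa [h2, hp] using h1

theorem memO_ofIdeal_range (h : A.IsFrame p x y) (hr : 1 ≤ r) (hp : p ≠ 0) (hp0 : p ∈ A.gr 0)
    (hpp : A.form p p ≠ 0) :
    (ofIdeal (h.isGraded_range hp hp0) (h.nondegenerateOn_range hpp) h.isIdeal_range).MemO := by
  refine Or.inr (Or.inr ⟨r, s, hr, ?_⟩)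
  set I := ofIdeal (h.isGraded_range hp hp0) (h.nondegenerateOn_range hpp) h.isIdeal_range
  set ι : I →ₗ[K] A :=
    ofIdealIncl (h.isGraded_range hp hp0) (h.nondegenerateOn_range hpp) h.isIdeal_range
  let φ : Matrix (Fin r ⊕ Fin s) (Fin r ⊕ Fin s) K ≃ₗ[K] I :=
    LinearEquiv.ofInjective (ofMatrix x y) (h.ofMatrix_injective hp)
  have hφ : ∀ M, ι (φ M) = ofMatrix x y M := fun M => rfl
  have hι : Function.Injective ι := Subtype.val_injective
  refine ⟨φ.symm, fun a b => ?_, fun i a => ?_⟩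
  · obtain ⟨M, rfl⟩ := φ.surjective a
    obtain ⟨N, rfl⟩ := φ.surjective b
    have : φ M * φ N = φ (M * N) := hι <|
      (ofIdealIncl_mul _ _ _ (φ M) (φ N)).trans (h.ofMatrix_mul M N).symm
    rw [this]
    change φ.symm (φ (M * N)) =
      (φ.symm (φ M) * φ.symm (φ N) : Matrix (Fin r ⊕ Fin s) (Fin r ⊕ Fin s) K)
    rw [φ.symm_apply_apply, φ.symm_apply_apply, φ.symm_apply_apply]
  · obtain ⟨M, rfl⟩ := φ.surjective a
    change φ.symm (φ M) ∈ matrixGr K r s i ↔ ofMatrix x y M ∈ A.gr i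
    rw [φ.symm_apply_apply]
    exact (h.ofMatrix_mem_gr_iff hp hp0).symm

end IsFrame

end EvenSymmSuperalgebra

/-! ### Annihilators when the even part is null, and the induction. -/

namespace EvenSymmSuperalgebra

open AssocSuperalgebra

variable {K : Type u} [Field K] {A : EvenSymmSuperalgebra.{u, v} K}

/-- A homogeneous left annihilator of `A` is a right annihilator. -/
theorem mul_eq_zero_of_left_annihilator {i : ZMod 2} {x : A} (hx : x ∈ A.gr i)
    (h : ∀ a, x * a = 0) (a : A) : a * x = 0 := by
  induction a using homogeneous_induction with
  | h j a ha =>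
    refine A.form_nondegenerate _ fun b => ?_
    rw [form_eq_zero_comm (A.mul_mem j i a x ha hx), ← A.form_assoc, ← form_eq_zero_comm hx,
      ← A.form_assoc, h, map_zero, LinearMap.zero_apply]
  | hadd a b ha hb => rw [add_mul, ha, hb, add_zero]

/-- If the even part of a nonzero superalgebra has null product, there is a nonzero homogeneous
annihilator. -/
theorem exists_homogeneous_annihilator (h00 : ∀ a ∈ A.gr 0, ∀ b ∈ A.gr 0, a * b = 0)
    (hA : ∃ x : A, x ≠ 0) :
    ∃ (i : ZMod 2), ∃ x ∈ A.gr i, x ≠ 0 ∧ ∀ a, x * a = 0 ∧ a * x = 0 := by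
  suffices ∃ (i : ZMod 2), ∃ x ∈ A.gr i, x ≠ 0 ∧
      ∀ j, ∀ a ∈ A.gr j, x * a = 0 by
    obtain ⟨i, x, hx, hx0, h⟩ := this
    have h' : ∀ a, x * a = 0 := by
      intro a
      induction a using homogeneous_induction with
      | h j a ha => exact h j a ha
      | hadd a b ha hb => rw [mul_add, ha, hb, add_zero]
    exact ⟨i, x, hx, hx0, fun a => ⟨h' a, mul_eq_zero_of_left_annihilator hx h' a⟩⟩
  by_contra! hno
  have hann : ∀ i, ∀ x ∈ A.gr i, (∀ j, ∀ a ∈ A.gr j, x * a = 0) → x = 0 := by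
    intro i x hx h
    by_contra hx0
    obtain ⟨j, a, ha, hxa⟩ := hno i x hx hx0
    exact hxa (h j a ha)
  have h011 : ∀ n ∈ A.gr 0, ∀ x ∈ A.gr 1, ∀ y ∈ A.gr 1, n * x * y = 0 := by
    intro n hn x hx y hy
    rw [mul_assoc]
    exact h00 n hn _ (A.mul_mem 1 1 x y hx hy)
  -- Without nonzero annihilators the grading collapses: A_0 A_1 A_1 ⊆ A_0 A_0 = 0, so A_0 A_1 A_0
  -- annihilates A and vanishes. Then A_0 A_1, next A_0, and finally A_1 vanish in the same way.
  have h010 : ∀ n ∈ A.gr 0, ∀ x ∈ A.gr 1, ∀ m ∈ A.gr 0, n * x * m = 0 := by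
    intro n hn x hx m hm
    refine hann 1 _ (A.mul_mem 1 0 _ m (A.mul_mem 0 1 n x hn hx) hm) fun j a ha => ?_
    rcases zmod_two_cases j with rfl | rfl
    · rw [mul_assoc, h00 m hm a ha, mul_zero]
    · rw [mul_assoc n, h011 n hn _ (A.mul_mem 1 0 x m hx hm) a ha]
  have h01 : ∀ n ∈ A.gr 0, ∀ x ∈ A.gr 1, n * x = 0 := by
    intro n hn x hx
    refine hann 1 _ (A.mul_mem 0 1 n x hn hx) fun j a ha => ?_
    rcases zmod_two_cases j with rfl | rfl
    exacts [h010 n hn x hx a ha, h011 n hn x hx a ha]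
  have h0 : ∀ n ∈ A.gr 0, n = 0 := by
    intro n hn
    refine hann 0 n hn fun j a ha => ?_
    rcases zmod_two_cases j with rfl | rfl
    exacts [h00 n hn a ha, h01 n hn a ha]
  have h1 : ∀ x ∈ A.gr 1, x = 0 := by
    intro x hx
    refine hann 1 x hx fun j a ha => ?_
    rcases zmod_two_cases j with rfl | rfl
    · rw [h0 a ha, mul_zero]
    · exact h0 _ (A.mul_mem 1 1 x a hx ha)
  obtain ⟨x, hx⟩ := hA
  obtain ⟨a, ha, b, hb, rfl⟩ := A.exists_add_eq x
  exact hx (by rw [h0 a ha, h1 b hb, add_zero])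

theorem exists_form_eq_one {i : ZMod 2} {f : A} (hf : f ∈ A.gr i) (hf0 : f ≠ 0) :
    ∃ e ∈ A.gr i, A.form f e = 1 := by
  have : ∃ y ∈ A.gr i, A.form f y ≠ 0 := by
    by_contra! h
    refine hf0 (A.form_nondegenerate f fun y => ?_)
    induction y using homogeneous_induction with
    | h j y hy =>
      by_cases hij : i = j
      · exact h y (hij ▸ hy)
      · exact form_eq_zero_of_mem hij hf hy
    | hadd a b ha hb => rw [map_add, ha, hb, add_zero]
  obtain ⟨y, hy, hfy⟩ := this
  exact ⟨(A.form f y)⁻¹ • y, Submodule.smul_mem _ _ hy, by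
    rw [map_smul, smul_eq_mul, inv_mul_cancel₀ hfy]⟩

theorem form_self_of_odd [CharZero K] {x : A} (hx : x ∈ A.gr 1) : A.form x x = 0 :=
  self_eq_neg.1 (form_comm_of_odd hx x)

theorem exists_isAnnihilatorPair_of_odd [CharZero K] {f : A} (hf : f ∈ A.gr 1) (hf0 : f ≠ 0)
    (h : ∀ a, f * a = 0 ∧ a * f = 0) : ∃ e, A.IsAnnihilatorPair 1 f e := by
  obtain ⟨e, he, hfe⟩ := exists_form_eq_one hf hf0
  exact ⟨e, hf, he, fun a => (h a).1, fun a => (h a).2, form_self_of_odd hf, hfe,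
    form_self_of_odd he, form_eq_zero_of_mem (by decide) (A.mul_mem 1 1 e e he he) he⟩

theorem exists_isAnnihilatorPair_of_even [CharZero K]
    (h00 : ∀ a ∈ A.gr 0, ∀ b ∈ A.gr 0, a * b = 0) {f : A} (hf : f ∈ A.gr 0) (hf0 : f ≠ 0)
    (hff : A.form f f = 0) (h : ∀ a, f * a = 0 ∧ a * f = 0) : ∃ e, A.IsAnnihilatorPair 0 f e := by
  obtain ⟨y, hy, hfy⟩ := exists_form_eq_one hf hf0
  have hyf : A.form y f = 1 := by rw [form_comm_of_even hy, hfy]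
  -- The multiple of f is chosen so that the corrected vector is isotropic; its pairing with f stays
  -- 1 because f is isotropic.
  have he : y - (A.form y y / 2) • f ∈ A.gr 0 := sub_mem hy (Submodule.smul_mem _ _ hf)
  refine ⟨_, hf, he, fun a => (h a).1, fun a => (h a).2, hff, ?_, ?_, ?_⟩
  · simp [hfy, hff]
  · simp only [map_sub, map_smul, LinearMap.sub_apply, LinearMap.smul_apply, smul_eq_mul, hfy, hff,
      hyf]
    ring
  · rw [h00 _ he _ he, map_zero, LinearMap.zero_apply]

theorem obtainedFromO_of_idempotent [IsAlgClosed K] [CharZero K] (hss : A.EvenPartSemisimple)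
    (ih : ∀ W : EvenSymmSuperalgebra.{u, v} K, Module.finrank K W < Module.finrank K A →
      W.EvenPartSemisimple → W.ObtainedFromO)
    (h : ∃ a ∈ A.gr 0, ∃ b ∈ A.gr 0, a * b ≠ 0) : A.ObtainedFromO := by
  obtain ⟨p, hp0, hp, hpp, hcor⟩ := exists_even_idempotent hss h
  have hprim : A.IsPrimitiveEven p := ⟨hp0, hp, hpp, hcor⟩
  obtain ⟨r, s, x, y, hr, hfr⟩ := hprim.exists_frame
  exact obtainedFromO_of_ideal hss ih _ _ _
    ((Submodule.ne_bot_iff _).2 ⟨p, by simpa [hpp] using hfr.mul_mem_range hpp hpp, hp⟩)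
    (hfr.memO_ofIdeal_range hr hp hp0 hprim.form_self_ne_zero)

theorem obtainedFromO_of_anisotropic (hss : A.EvenPartSemisimple)
    (ih : ∀ W : EvenSymmSuperalgebra.{u, v} K, Module.finrank K W < Module.finrank K A →
      W.EvenPartSemisimple → W.ObtainedFromO)
    {f : A} (hf : f ∈ A.gr 0) (hff : A.form f f ≠ 0) (h : ∀ a, f * a = 0 ∧ a * f = 0) :
    A.ObtainedFromO := by
  have hf0 : f ≠ 0 := by rintro rfl; simp at hff
  have hI : A.IsGraded (Submodule.span K {f}) := isGraded_span_of_mem (i := 0) (by simpa using hf)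
  have hn : A.NondegenerateOn (Submodule.span K {f}) := by
    intro x hx hx'
    obtain ⟨c, rfl⟩ := Submodule.mem_span_singleton.1 hx
    have := hx' f (Submodule.mem_span_singleton_self f)
    rw [map_smul, LinearMap.smul_apply, smul_eq_mul, mul_eq_zero, or_iff_left hff] at this
    rw [this, zero_smul]
  have hann : ∀ a, ∀ x ∈ Submodule.span K {f}, a * x = 0 ∧ x * a = 0 := by
    intro a x hx
    obtain ⟨c, rfl⟩ := Submodule.mem_span_singleton.1 hx
    rw [mul_smul_comm, smul_mul_assoc, (h a).1, (h a).2, smul_zero]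
    exact ⟨rfl, rfl⟩
  have hid : A.IsIdeal (Submodule.span K {f}) := by
    intro a x hx
    rw [(hann a x hx).1, (hann a x hx).2]
    exact ⟨zero_mem _, zero_mem _⟩
  refine obtainedFromO_of_ideal hss ih hI hn hid ((Submodule.ne_bot_iff _).2
    ⟨f, Submodule.mem_span_singleton_self f, hf0⟩) (Or.inr (Or.inl ⟨finrank_span_singleton hf0,
      eq_top_iff.2 fun x _ => ?_, fun x y => ?_⟩))
  · exact Submodule.span_le.2 (Set.singleton_subset_iff.2 hf) (ofIdealIncl_mem hI hn hid x)
  · have hinj : Function.Injective (ofIdealIncl hI hn hid) := Subtype.val_injective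
    apply hinj
    rw [ofIdealIncl_mul, map_zero]
    exact (hann _ _ (ofIdealIncl_mem hI hn hid y)).1

/-- The three cases are an even isotropic annihilator (elementary extension), an even anisotropic
one (null summand), and an odd one, always isotropic (odd extension). -/
theorem obtainedFromO_of_even_null [CharZero K] (hss : A.EvenPartSemisimple)
    (ih : ∀ W : EvenSymmSuperalgebra.{u, v} K, Module.finrank K W < Module.finrank K A →
      W.EvenPartSemisimple → W.ObtainedFromO)
    (h00 : ∀ a ∈ A.gr 0, ∀ b ∈ A.gr 0, a * b = 0) (hA : ∃ x : A, x ≠ 0) : A.ObtainedFromO := by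
  obtain ⟨i, f, hf, hf0, h⟩ := exists_homogeneous_annihilator h00 hA
  rcases zmod_two_cases i with rfl | rfl
  · by_cases hff : A.form f f = 0
    · obtain ⟨e, he⟩ := exists_isAnnihilatorPair_of_even h00 hf hf0 hff h
      exact .elementary he.base A
        (ih _ he.finrank_base_lt (he.evenPartSemisimple_base_of_even h00 hss))
        (he.isElementaryEvenDoubleExtension h00 hss)
    · exact obtainedFromO_of_anisotropic hss ih hf hff h
  · obtain ⟨e, he⟩ := exists_isAnnihilatorPair_of_odd hf hf0 h
    exact .odd he.base A (ih _ he.finrank_base_lt (he.evenPartSemisimple_base_of_odd hss))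
      he.isOddGeneralizedDoubleExtension

theorem obtainedFromO_of_evenPartSemisimple [IsAlgClosed K] [CharZero K]
    (A : EvenSymmSuperalgebra.{u, v} K) (hss : A.EvenPartSemisimple) : A.ObtainedFromO := by
  induction hd : Module.finrank K A using Nat.strong_induction_on generalizing A with
  | _ d ih =>
    subst hd
    have ih' : ∀ W : EvenSymmSuperalgebra.{u, v} K, Module.finrank K W < Module.finrank K A →
        W.EvenPartSemisimple → W.ObtainedFromO := fun W hW hWss => ih _ hW W hWss rfl
    by_cases h : ∃ a ∈ A.gr 0, ∃ b ∈ A.gr 0, a * b ≠ 0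
    · exact obtainedFromO_of_idempotent hss ih' h
    · push Not at h
      by_cases hA : ∃ x : A, x ≠ 0
      · exact obtainedFromO_of_even_null hss ih' h hA
      · push Not at hA
        have : Subsingleton A := ⟨fun x y => by rw [hA x, hA y]⟩
        exact .base A (Or.inl Module.finrank_zero_of_subsingleton)

end EvenSymmSuperalgebra

theorem mainTheorem8 {K : Type u} [Field K] [IsAlgClosed K] [CharZero K]
    (A : EvenSymmSuperalgebra.{u, v} K) (hss : A.EvenPartSemisimple) (hO : ¬ A.MemO) :
    A.ObtainedFromO :=
  EvenSymmSuperalgebra.obtainedFromO_of_evenPartSemisimple A hss
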